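/- Let $s,t,r\in\mathbb{C}$ and let $\mathbb{D}$ be the open unit disc in $\mathbb{C}$. Write $\partial=\tfrac12(\partial_x-i\partial_y)$ and $\bar\partial=\tfrac12(\partial_x+i\partial_y)$, put $(x,y)_0=1$, $(x,y)_n=x(x+y)(x+2y)\cdots(x+(n-1)y)$ and $(x)_n=(x,1)_n$, and let $$\mathcal{P}(\alpha,\beta\,|\,\gamma;z)=\sum_{n=0}^{\infty}\frac{(\alpha,\beta)_n}{(\gamma)_n}\frac{z^n}{n!}.$$ (1) A function $u:\mathbb{D}\to\mathbb{C}$ is twice continuously differentiable and satisfies $$\partial\bar\partial u-sz\,\partial u-t\bar z\,\bar\partial u-ru=0\quad\text{in }\mathbb{D}$$ if and only if there is a family $\{k_m\}_{m\in\mathbb{Z}}$ of complex numbers with $$\limsup_{|m|\to\infty}|k_m|^{1/|m|}\le 1 \tag{$*$}$$ such that, for every $z\in\mathbb{D}$, both of the following series converge and $$u(z)=\sum_{m=0}^{\infty}k_m\,\mathcal{P}(r+sm,s+t\,|\,m+1;|z|^2)\,z^m+\sum_{m=1}^{\infty}k_{-m}\,\mathcal{P}(r+tm,t+s\,|\,m+1;|z|^2)\,\bar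 z^m. \tag{$**$}$$ (2) Whenever $\{k_m\}_{m\in\mathbb{Z}}$ satisfies $(*)$, the series in $(**)$ is absolutely convergent in $C^\infty(\mathbb{D})$: all its terms are smooth, the sum over all terms $f$ of $\|f\|_{j,l,K}=\max_{z\in K}|\partial^j\bar\partial^l f(z)|$ is finite for all integers $j,l\ge 0$ and all compact $K\subset\mathbb{D}$, and the series converges with respect to each of these seminorms to its pointwise sum, which is a smooth function on $\mathbb{D}$. -/

import Mathlib

open scoped ENNReal ContDiff

noncomputable section

namespace GenHarm

/-- The open unit disc. -/
def disc : Set ℂ := Metric.ball 0 1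

/-- The complex derivative `∂ = (∂ₓ - i ∂_y) / 2`. -/
def dz (f : ℂ → ℂ) (z : ℂ) : ℂ :=
  (fderiv ℝ f z 1 - Complex.I * fderiv ℝ f z Complex.I) / 2

/-- The complex derivative `∂̄ = (∂ₓ + i ∂_y) / 2`. -/
def dbar (f : ℂ → ℂ) (z : ℂ) : ℂ :=
  (fderiv ℝ f z 1 + Complex.I * fderiv ℝ f z Complex.I) / 2

/-- The operator `M_{s,t,r} = ∂∂̄ - s z ∂ - t z̄ ∂̄ - r`. -/
def opM (s t r : ℂ) (u : ℂ → ℂ) (z : ℂ) : ℂ :=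
  dz (dbar u) z - s * z * dz u z - t * starRingEnd ℂ z * dbar u z - r * u z

/-- `u` is a solution on the unit disc: it is `C²` there and `M_{s,t,r} u = 0` there
(the values of `u` outside the disc are irrelevant). -/
def IsSolution (s t r : ℂ) (u : ℂ → ℂ) : Prop :=
  ContDiffOn ℝ 2 u disc ∧ ∀ z ∈ disc, opM s t r u z = 0

/-- The generalised Pochhammer symbol `(x,y)_n = x (x+y) (x+2y) ⋯ (x+(n-1)y)`. -/
def poch (x y : ℂ) (n : ℕ) : ℂ := ∏ i ∈ Finset.range n, (x + i * y)

/-- `𝒫(α, β | γ; z) = ∑_{k ≥ 0} (α,β)_k / (γ)_k · z^k / k!`, where `(γ)_k = (γ,1)_k`. -/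
def calP (α β γ z : ℂ) : ℂ :=
  ∑' k : ℕ, poch α β k / poch γ 1 k * (z ^ k / (k.factorial : ℂ))

/-- The `m`-th term of the expansion, `m ∈ ℤ`:
`k_m 𝒫(r+sm, s+t | m+1; |z|²) z^m` for `m ≥ 0` and
`k_m 𝒫(r+t|m|, t+s | |m|+1; |z|²) z̄^|m|` for `m < 0`. -/
def term (s t r : ℂ) (k : ℤ → ℂ) (m : ℤ) (z : ℂ) : ℂ :=
  if 0 ≤ m then
    k m * calP (r + s * m.natAbs) (s + t) (m.natAbs + 1) ((‖z‖ : ℂ) ^ 2) * z ^ m.natAbs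
  else
    k m * calP (r + t * m.natAbs) (t + s) (m.natAbs + 1) ((‖z‖ : ℂ) ^ 2) *
      starRingEnd ℂ z ^ m.natAbs

/-- `limsup_{|m| → ∞} |k_m|^{1/|m|} ≤ 1`, the upper limit being taken in `[0, ∞]`. -/
def RootCondition (k : ℤ → ℂ) : Prop :=
  Filter.limsup (fun m : ℤ => ‖k m‖ₑ ^ (1 / (m.natAbs : ℝ)))
    (Filter.comap (fun m : ℤ => |m|) Filter.atTop) ≤ 1

/-- The semi-norm `‖f‖_{j,l,K} = max_{z ∈ K} |∂^j ∂̄^l f(z)|`. -/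
def smoothSeminorm (j l : ℕ) (K : Set ℂ) (f : ℂ → ℂ) : ℝ :=
  ⨆ z : K, ‖dz^[j] (dbar^[l] f) z‖

/-- The family `f` consists of smooth functions on the disc and is absolutely summable with
respect to each of the semi-norms of `C^∞(𝔻)`. -/
def AbsConvergent (f : ℤ → ℂ → ℂ) : Prop :=
  (∀ m, ContDiffOn ℝ ∞ (f m) disc) ∧
    ∀ (j l : ℕ) (K : Set ℂ), IsCompact K → K ⊆ disc →
      Summable fun m : ℤ => smoothSeminorm j l K (f m)

/-- `∑_{m ∈ ℤ} f_m = u` with (unconditional) convergence in `C^∞(𝔻)`. -/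
def HasSmoothSum (f : ℤ → ℂ → ℂ) (u : ℂ → ℂ) : Prop :=
  ContDiffOn ℝ ∞ u disc ∧
    ∀ (j l : ℕ) (K : Set ℂ), IsCompact K → K ⊆ disc →
      Filter.Tendsto
        (fun F : Finset ℤ => smoothSeminorm j l K (fun z => (∑ m ∈ F, f m z) - u z))
        Filter.atTop (nhds 0)

end GenHarm

end

/-!
Where a double power series `∑ c_{pq} z^p z̄^q` converges absolutely on the disc, `M_{s,t,r}`
annihilates it as soon as `(p + 1)(q + 1) c_{p+1,q+1} = (sp + tq + r) c_{pq}`. Along each diagonal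
`p - q = m` this recurrence has a one-parameter family of solutions, the multiples of the `m`-th
term of the expansion, and the root condition makes the resulting double series converge.

Conversely, `M_{s,t,r}` commutes with rotations, so the Fourier components of a solution over the
circles `|z| = R` are solutions which rotations multiply by a character. For two solutions `u`, `v`
of the same weight, Abel's formula shows that `x exp(-(s + t)x²) (u ∂̄v - v ∂̄u)` is constant on the
radius `[0, 1)`; it vanishes at `0`, so `u` and `v` are proportional. Hence the `m`-th component is
`k_m` times the `m`-th term. Since the hypergeometric factors tend to `exp(sR²)` and `exp(tR²)` as
`m → ±∞`, the boundedness of the components on `|z| = R` forces the root condition.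
-/

noncomputable section

namespace GenHarm

open Filter Topology MeasureTheory ComplexConjugate

theorem isOpen_disc : IsOpen disc := Metric.isOpen_ball

theorem mem_disc {z : ℂ} : z ∈ disc ↔ ‖z‖ < 1 := by simp [disc]

theorem ofReal_mem_disc {x : ℝ} (hx : x ∈ Set.Ioo (0 : ℝ) 1) : (x : ℂ) ∈ disc := by
  simpa [mem_disc, abs_of_pos hx.1] using hx.2

theorem exists_norm_le_of_isCompact {K : Set ℂ} (hK : IsCompact K) (hKD : K ⊆ disc) :
    ∃ R ∈ Set.Ioo (0 : ℝ) 1, ∀ z ∈ K, ‖z‖ ≤ R := by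
  obtain ⟨R, hR, hKR⟩ := exists_pos_lt_subset_ball one_pos hK.isClosed hKD
  exact ⟨R, hR, fun z hz => (mem_ball_zero_iff.1 (hKR hz)).le⟩

/-! ### Wirtinger derivatives -/

/-- The real linear map `w ↦ a w + b w̄`: the differential of a function `f` at a point where
`∂f = a` and `∂̄f = b`. -/
def wirtinger (a b : ℂ) : ℂ →L[ℝ] ℂ :=
  a • ContinuousLinearMap.id ℝ ℂ + b • (Complex.conjCLE : ℂ →L[ℝ] ℂ)

@[simp]
theorem wirtinger_apply (a b w : ℂ) : wirtinger a b w = a * w + b * conj w := by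
  simp [wirtinger]

theorem norm_wirtinger_le (a b : ℂ) : ‖wirtinger a b‖ ≤ ‖a‖ + ‖b‖ := by
  refine ContinuousLinearMap.opNorm_le_bound _ (by positivity) fun w => ?_
  rw [wirtinger_apply, add_mul]
  exact (norm_add_le _ _).trans (by simp)

theorem hasSum_wirtinger {ι : Type*} {f g : ι → ℂ} {a b : ℂ} (hf : HasSum f a)
    (hg : HasSum g b) : HasSum (fun i => wirtinger (f i) (g i)) (wirtinger a b) :=
  (hf.smul_const _).add (hg.smul_const _)

theorem fderiv_eq_wirtinger (f : ℂ → ℂ) (z : ℂ) :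
    fderiv ℝ f z = wirtinger (dz f z) (dbar f z) := by
  refine ContinuousLinearMap.ext fun w => ?_
  have hw : fderiv ℝ f z w = w.re * fderiv ℝ f z 1 + w.im * fderiv ℝ f z Complex.I := by
    conv_lhs => rw [show w = w.re • (1 : ℂ) + w.im • Complex.I by simp]
    rw [map_add, map_smul, map_smul, Complex.real_smul, Complex.real_smul]
  have hre : (w.re : ℂ) = (w + conj w) / 2 := Complex.re_eq_add_conj w
  have him : (w.im : ℂ) = (w - conj w) / (2 * Complex.I) := Complex.im_eq_sub_conj w
  rw [wirtinger_apply, hw, dz, dbar, hre, him]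
  field_simp
  linear_combination (fderiv ℝ f z Complex.I * (w - conj w)) * Complex.I_sq

theorem hasFDerivAt_wirtinger {f : ℂ → ℂ} {z : ℂ} (hf : DifferentiableAt ℝ f z) :
    HasFDerivAt f (wirtinger (dz f z) (dbar f z)) z :=
  fderiv_eq_wirtinger f z ▸ hf.hasFDerivAt

theorem dz_eq_of_hasFDerivAt {f : ℂ → ℂ} {a b z : ℂ} (h : HasFDerivAt f (wirtinger a b) z) :
    dz f z = a := by
  simp only [dz, h.fderiv, wirtinger_apply, map_one, Complex.conj_I]
  linear_combination (b - a) / 2 * Complex.I_sq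

theorem dbar_eq_of_hasFDerivAt {f : ℂ → ℂ} {a b z : ℂ} (h : HasFDerivAt f (wirtinger a b) z) :
    dbar f z = b := by
  simp only [dbar, h.fderiv, wirtinger_apply, map_one, Complex.conj_I]
  linear_combination (a - b) / 2 * Complex.I_sq

theorem dbar_const_mul {f : ℂ → ℂ} {z : ℂ} (c : ℂ) (hf : DifferentiableAt ℝ f z) :
    dbar (fun w => c * f w) z = c * dbar f z := by
  simp only [dbar, fderiv_const_mul hf, smul_apply, smul_eq_mul]
  ring

section OpenSet

variable {U : Set ℂ} {f g a b : ℂ → ℂ} {n : ℕ∞}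

theorem contDiffOn_succ_of_hasFDerivAt_wirtinger (hU : IsOpen U)
    (h : ∀ z ∈ U, HasFDerivAt f (wirtinger (a z) (b z)) z)
    (ha : ContDiffOn ℝ n a U) (hb : ContDiffOn ℝ n b U) : ContDiffOn ℝ (n + 1) f U := by
  refine (contDiffOn_succ_iff_fderiv_of_isOpen hU).2
    ⟨fun z hz => (h z hz).differentiableAt.differentiableWithinAt, by simp, ?_⟩
  have hwirt : ContDiffOn ℝ n (fun z => wirtinger (a z) (b z)) U :=
    (ha.smul contDiffOn_const).add (hb.smul contDiffOn_const)
  exact hwirt.congr fun z hz => (h z hz).fderiv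

theorem contDiffOn_dz (hU : IsOpen U) (hf : ContDiffOn ℝ (n + 1) f U) :
    ContDiffOn ℝ n (dz f) U := by
  have hfd := hf.fderiv_of_isOpen hU le_rfl
  exact ((hfd.clm_apply contDiffOn_const).sub
    (contDiffOn_const.mul (hfd.clm_apply contDiffOn_const))).div_const 2

theorem contDiffOn_dbar (hU : IsOpen U) (hf : ContDiffOn ℝ (n + 1) f U) :
    ContDiffOn ℝ n (dbar f) U := by
  have hfd := hf.fderiv_of_isOpen hU le_rfl
  exact ((hfd.clm_apply contDiffOn_const).add
    (contDiffOn_const.mul (hfd.clm_apply contDiffOn_const))).div_const 2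

theorem dz_eqOn (hU : IsOpen U) (h : Set.EqOn f g U) : Set.EqOn (dz f) (dz g) U := fun z hz => by
  simp only [dz, (h.eventuallyEq_of_mem (hU.mem_nhds hz)).fderiv_eq]

theorem dbar_eqOn (hU : IsOpen U) (h : Set.EqOn f g U) : Set.EqOn (dbar f) (dbar g) U :=
  fun z hz => by simp only [dbar, (h.eventuallyEq_of_mem (hU.mem_nhds hz)).fderiv_eq]

theorem iterate_dz_eqOn (hU : IsOpen U) (h : Set.EqOn f g U) (j : ℕ) :
    Set.EqOn (dz^[j] f) (dz^[j] g) U := by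
  induction j generalizing f g with
  | zero => exact h
  | succ _ ih => exact ih (dz_eqOn hU h)

theorem iterate_dbar_eqOn (hU : IsOpen U) (h : Set.EqOn f g U) (l : ℕ) :
    Set.EqOn (dbar^[l] f) (dbar^[l] g) U := by
  induction l generalizing f g with
  | zero => exact h
  | succ _ ih => exact ih (dbar_eqOn hU h)

theorem opM_eqOn (s t r : ℂ) (hU : IsOpen U) (h : Set.EqOn f g U) :
    Set.EqOn (opM s t r f) (opM s t r g) U := fun z hz => by
  simp only [opM, dz_eqOn hU (dbar_eqOn hU h) hz, dz_eqOn hU h hz, dbar_eqOn hU h hz, h hz]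

end OpenSet

section OnDisc

variable {s t r : ℂ} {f g : ℂ → ℂ}

theorem IsSolution.congr (hf : IsSolution s t r f) (h : Set.EqOn g f disc) :
    IsSolution s t r g :=
  ⟨hf.1.congr h, fun z hz => (opM_eqOn s t r isOpen_disc h hz).trans (hf.2 z hz)⟩

theorem smoothSeminorm_congr {K : Set ℂ} (hKD : K ⊆ disc) (h : Set.EqOn f g disc) (j l : ℕ) :
    smoothSeminorm j l K f = smoothSeminorm j l K g :=
  iSup_congr fun z =>
    congrArg norm (iterate_dz_eqOn isOpen_disc (iterate_dbar_eqOn isOpen_disc h l) j (hKD z.2))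

theorem smoothSeminorm_nonneg (j l : ℕ) (K : Set ℂ) (f : ℂ → ℂ) :
    0 ≤ smoothSeminorm j l K f :=
  Real.iSup_nonneg fun _ => norm_nonneg _

end OnDisc

/-! ### Double power series in `z` and `z̄` -/

/-- The double series `∑ c_{p,q} z^p z̄^q` converges absolutely on the unit disc. -/
def DiscSummable (c : ℕ × ℕ → ℂ) : Prop :=
  ∀ R ∈ Set.Ioo (0 : ℝ) 1, Summable fun i => ‖c i‖ * R ^ (i.1 + i.2)

/-- The sum of the double series `∑ c_{p,q} z^p z̄^q`. -/
def doubleSeries (c : ℕ × ℕ → ℂ) (z : ℂ) : ℂ :=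
  ∑' i : ℕ × ℕ, c i * (z ^ i.1 * conj z ^ i.2)

/-- The coefficients of `∂` of the double series with coefficients `c`. -/
def coeffDz (c : ℕ × ℕ → ℂ) (i : ℕ × ℕ) : ℂ := (i.1 + 1 : ℕ) * c (i.1 + 1, i.2)

/-- The coefficients of `∂̄` of the double series with coefficients `c`. -/
def coeffDbar (c : ℕ × ℕ → ℂ) (i : ℕ × ℕ) : ℂ := (i.2 + 1 : ℕ) * c (i.1, i.2 + 1)

/-- The coefficients of `∂^j ∂̄^l` of the double series with coefficients `c`. -/
def coeffDeriv (j l : ℕ) (c : ℕ × ℕ → ℂ) : ℕ × ℕ → ℂ := coeffDz^[j] (coeffDbar^[l] c)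

theorem natCast_mul_pow_mul_sub_le {R S : ℝ} (hR : 0 ≤ R) (hRS : R ≤ S) (n : ℕ) :
    n * R ^ (n - 1) * (S - R) ≤ S ^ n - R ^ n := by
  induction n with
  | zero => simp
  | succ n ih =>
    have hpow : n * R ^ (n - 1) * R = n * R ^ n := by
      rcases n with _ | n
      · simp
      · rw [Nat.add_sub_cancel]; ring
    have hdiff : 0 ≤ (S - R) * (S ^ n - R ^ n) :=
      mul_nonneg (sub_nonneg.2 hRS) (sub_nonneg.2 (pow_le_pow_left₀ hR hRS n))
    have hmul := mul_le_mul_of_nonneg_right ih hR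
    rw [Nat.add_sub_cancel, pow_succ, pow_succ]
    push_cast
    linear_combination hmul + hdiff - (S - R) * hpow

theorem norm_monomial_le {z : ℂ} {R : ℝ} (hz : ‖z‖ ≤ R) (p q : ℕ) :
    ‖z ^ p * conj z ^ q‖ ≤ R ^ (p + q) := by
  rw [norm_mul, norm_pow, norm_pow, RCLike.norm_conj, ← pow_add]
  gcongr

theorem norm_deriv_monomial_le {z : ℂ} {R : ℝ} (hz : ‖z‖ ≤ R) (p q : ℕ) :
    ‖p * (z ^ (p - 1) * conj z ^ q)‖ + ‖q * (z ^ p * conj z ^ (q - 1))‖ ≤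
      (p + q : ℕ) * R ^ (p + q - 1) := by
  have hdz : ‖p * (z ^ (p - 1) * conj z ^ q)‖ ≤ p * R ^ (p + q - 1) := by
    rcases p with _ | p
    · simp
    rw [norm_mul, Complex.norm_natCast, show p + 1 + q - 1 = p + 1 - 1 + q by omega]
    gcongr
    exact norm_monomial_le hz _ _
  have hdbar : ‖q * (z ^ p * conj z ^ (q - 1))‖ ≤ q * R ^ (p + q - 1) := by
    rcases q with _ | q
    · simp
    rw [norm_mul, Complex.norm_natCast, show p + (q + 1) - 1 = p + (q + 1 - 1) by omega]
    gcongr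
    exact norm_monomial_le hz _ _
  push_cast
  linear_combination hdz + hdbar

theorem hasFDerivAt_monomial (p q : ℕ) (z : ℂ) :
    HasFDerivAt (fun z : ℂ => z ^ p * conj z ^ q)
      (wirtinger (p * (z ^ (p - 1) * conj z ^ q)) (q * (z ^ p * conj z ^ (q - 1)))) z := by
  have hpow (n : ℕ) (w : ℂ) : HasFDerivAt (fun z : ℂ => z ^ n) _ w :=
    (hasDerivAt_pow n w).hasFDerivAt.restrictScalars ℝ
  have hconj : HasFDerivAt (fun z : ℂ => conj z) (Complex.conjCLE : ℂ →L[ℝ] ℂ) z :=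
    Complex.conjCLE.hasFDerivAt
  refine ((hpow p z).mul ((hpow q (conj z)).comp z hconj)).congr_fderiv ?_
  ext w
  simp
  ring

theorem injective_succ_fst : Function.Injective fun i : ℕ × ℕ => (i.1 + 1, i.2) :=
  fun i j h => by simpa [Prod.ext_iff] using h

theorem injective_succ_snd : Function.Injective fun i : ℕ × ℕ => (i.1, i.2 + 1) :=
  fun i j h => by simpa [Prod.ext_iff] using h

theorem coeffDeriv_indicator (j l : ℕ) (S : Set (ℕ × ℕ)) (c : ℕ × ℕ → ℂ) :
    coeffDeriv j l (S.indicator c) =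
      ((fun i => (i.1 + j, i.2 + l)) ⁻¹' S).indicator (coeffDeriv j l c) := by
  have hdz (S : Set (ℕ × ℕ)) (c : ℕ × ℕ → ℂ) : coeffDz (S.indicator c) =
      ((fun i => (i.1 + 1, i.2)) ⁻¹' S).indicator (coeffDz c) := by
    classical
    funext i
    simp only [coeffDz, Set.indicator_apply, Set.mem_preimage, mul_ite, mul_zero]
  have hdbar (S : Set (ℕ × ℕ)) (c : ℕ × ℕ → ℂ) : coeffDbar (S.indicator c) =
      ((fun i => (i.1, i.2 + 1)) ⁻¹' S).indicator (coeffDbar c) := by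
    classical
    funext i
    simp only [coeffDbar, Set.indicator_apply, Set.mem_preimage, mul_ite, mul_zero]
  induction j with
  | zero =>
    induction l with
    | zero => rfl
    | succ l ih =>
      simp only [coeffDeriv, Function.iterate_zero, id, Function.iterate_succ_apply'] at ih ⊢
      rw [ih, hdbar, ← Set.preimage_comp]
      simp only [Function.comp_def, add_assoc, add_comm 1 l]
  | succ j ih =>
    simp only [coeffDeriv, Function.iterate_succ_apply'] at ih ⊢
    rw [ih, hdz, ← Set.preimage_comp]
    simp only [Function.comp_def, add_assoc, add_comm 1 j]

namespace DiscSummable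

variable {c : ℕ × ℕ → ℂ}

theorem mono {d : ℕ × ℕ → ℂ} (hc : DiscSummable c) (h : ∀ i, ‖d i‖ ≤ ‖c i‖) :
    DiscSummable d := fun R hR =>
  (hc R hR).of_nonneg_of_le (fun _ => mul_nonneg (norm_nonneg _) (pow_nonneg hR.1.le _))
    fun i => mul_le_mul_of_nonneg_right (h i) (pow_nonneg hR.1.le _)

theorem neg (hc : DiscSummable c) : DiscSummable (-c) := hc.mono fun i => (norm_neg (c i)).le

theorem indicator (hc : DiscSummable c) (S : Set (ℕ × ℕ)) : DiscSummable (S.indicator c) :=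
  hc.mono fun _ => norm_indicator_le_norm_self _ _

theorem summable_deriv (hc : DiscSummable c) {R : ℝ} (hR : R ∈ Set.Ioo (0 : ℝ) 1) :
    Summable fun i => ‖c i‖ * ((i.1 + i.2 : ℕ) * R ^ (i.1 + i.2 - 1)) := by
  obtain ⟨S, hRS, hS⟩ := exists_between hR.2
  refine ((hc S ⟨hR.1.trans hRS, hS⟩).div_const (S - R)).of_nonneg_of_le
    (fun i => mul_nonneg (norm_nonneg _)
      (mul_nonneg (Nat.cast_nonneg _) (pow_nonneg hR.1.le _))) fun i => ?_
  rw [mul_div_assoc]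
  refine mul_le_mul_of_nonneg_left ?_ (norm_nonneg _)
  rw [le_div_iff₀ (sub_pos.2 hRS)]
  exact (natCast_mul_pow_mul_sub_le hR.1.le hRS.le _).trans
    (sub_le_self _ (pow_nonneg hR.1.le _))

protected theorem coeffDz (hc : DiscSummable c) : DiscSummable (coeffDz c) := by
  intro R hR
  have hR0 := hR.1.le
  refine ((hc.summable_deriv hR).comp_injective injective_succ_fst).of_nonneg_of_le
    (fun i => by positivity) fun i => ?_
  simp only [Function.comp, GenHarm.coeffDz, norm_mul, Complex.norm_natCast]
  rw [show i.1 + 1 + i.2 - 1 = i.1 + i.2 by omega, mul_comm (_ : ℝ) ‖c _‖, mul_assoc]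
  have hle : i.1 + 1 ≤ i.1 + 1 + i.2 := by omega
  gcongr

protected theorem coeffDbar (hc : DiscSummable c) : DiscSummable (coeffDbar c) := by
  intro R hR
  have hR0 := hR.1.le
  refine ((hc.summable_deriv hR).comp_injective injective_succ_snd).of_nonneg_of_le
    (fun i => by positivity) fun i => ?_
  simp only [Function.comp, GenHarm.coeffDbar, norm_mul, Complex.norm_natCast]
  rw [show i.1 + (i.2 + 1) - 1 = i.1 + i.2 by omega, mul_comm (_ : ℝ) ‖c _‖, mul_assoc]
  have hle : i.2 + 1 ≤ i.1 + (i.2 + 1) := by omega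
  gcongr

theorem iterate_coeffDbar (hc : DiscSummable c) (l : ℕ) :
    DiscSummable (GenHarm.coeffDbar^[l] c) :=
  Function.Iterate.rec DiscSummable hc (fun _ => DiscSummable.coeffDbar) l

protected theorem coeffDeriv (hc : DiscSummable c) (j l : ℕ) :
    DiscSummable (coeffDeriv j l c) :=
  Function.Iterate.rec DiscSummable (hc.iterate_coeffDbar l) (fun _ => DiscSummable.coeffDz) j

theorem summable_norm (hc : DiscSummable c) {z : ℂ} (hz : z ∈ disc) :
    Summable fun i : ℕ × ℕ => ‖c i * (z ^ i.1 * conj z ^ i.2)‖ := by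
  obtain ⟨R, hzR, hR⟩ := exists_between (mem_disc.1 hz)
  refine (hc R ⟨(norm_nonneg z).trans_lt hzR, hR⟩).of_nonneg_of_le
    (fun _ => norm_nonneg _) fun i => ?_
  rw [norm_mul]
  gcongr
  exact norm_monomial_le hzR.le _ _

theorem hasSum (hc : DiscSummable c) {z : ℂ} (hz : z ∈ disc) :
    HasSum (fun i : ℕ × ℕ => c i * (z ^ i.1 * conj z ^ i.2)) (doubleSeries c z) :=
  (hc.summable_norm hz).of_norm.hasSum

theorem norm_doubleSeries_le (hc : DiscSummable c) {z : ℂ} {R : ℝ} (hR : R ∈ Set.Ioo (0 : ℝ) 1)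
    (hz : ‖z‖ ≤ R) : ‖doubleSeries c z‖ ≤ ∑' i : ℕ × ℕ, ‖c i‖ * R ^ (i.1 + i.2) := by
  refine tsum_of_norm_bounded (hc R hR).hasSum fun i => ?_
  rw [norm_mul]
  gcongr
  exact norm_monomial_le hz _ _

theorem hasSum_coeffDz (hc : DiscSummable c) {z : ℂ} (hz : z ∈ disc) :
    HasSum (fun i : ℕ × ℕ => c i * (i.1 * (z ^ (i.1 - 1) * conj z ^ i.2)))
      (doubleSeries (GenHarm.coeffDz c) z) := by
  refine (injective_succ_fst.hasSum_iff ?_).1 ((hc.coeffDz.hasSum hz).congr_fun fun i => ?_)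
  · rintro ⟨_ | p, q⟩ h
    · simp
    · exact absurd ⟨(p, q), rfl⟩ h
  · simp only [Function.comp, GenHarm.coeffDz, Nat.add_sub_cancel]
    ring

theorem hasSum_coeffDbar (hc : DiscSummable c) {z : ℂ} (hz : z ∈ disc) :
    HasSum (fun i : ℕ × ℕ => c i * (i.2 * (z ^ i.1 * conj z ^ (i.2 - 1))))
      (doubleSeries (GenHarm.coeffDbar c) z) := by
  refine (injective_succ_snd.hasSum_iff ?_).1 ((hc.coeffDbar.hasSum hz).congr_fun fun i => ?_)
  · rintro ⟨p, _ | q⟩ h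
    · simp
    · exact absurd ⟨(p, q), rfl⟩ h
  · simp only [Function.comp, GenHarm.coeffDbar, Nat.add_sub_cancel]
    ring

theorem hasFDerivAt (hc : DiscSummable c) {z : ℂ} (hz : z ∈ disc) :
    HasFDerivAt (doubleSeries c) (wirtinger (doubleSeries (GenHarm.coeffDz c) z)
      (doubleSeries (GenHarm.coeffDbar c) z)) z := by
  obtain ⟨R, hzR, hR⟩ := exists_between (mem_disc.1 hz)
  have hzball : z ∈ Metric.ball (0 : ℂ) R := mem_ball_zero_iff.2 hzR
  rw [← (hasSum_wirtinger (hc.hasSum_coeffDz hz) (hc.hasSum_coeffDbar hz)).tsum_eq]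
  refine hasFDerivAt_tsum_of_isPreconnected
    (f := fun (i : ℕ × ℕ) (w : ℂ) => c i * (w ^ i.1 * conj w ^ i.2))
    (f' := fun i w => wirtinger (c i * (i.1 * (w ^ (i.1 - 1) * conj w ^ i.2)))
      (c i * (i.2 * (w ^ i.1 * conj w ^ (i.2 - 1)))))
    (hc.summable_deriv ⟨(norm_nonneg z).trans_lt hzR, hR⟩) Metric.isOpen_ball
    (convex_ball _ _).isPreconnected (fun i w _ => ?_) (fun i w hw => ?_) hzball
    (hc.hasSum hz).summable hzball
  · refine ((hasFDerivAt_monomial i.1 i.2 w).const_mul (c i)).congr_fderiv ?_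
    ext v
    simp
    ring
  · refine (norm_wirtinger_le _ _).trans ?_
    rw [norm_mul (c i), norm_mul (c i), ← mul_add]
    gcongr
    exact norm_deriv_monomial_le (mem_ball_zero_iff.1 hw).le _ _

theorem dz_doubleSeries (hc : DiscSummable c) :
    Set.EqOn (dz (doubleSeries c)) (doubleSeries (GenHarm.coeffDz c)) disc :=
  fun _ hz => dz_eq_of_hasFDerivAt (hc.hasFDerivAt hz)

theorem dbar_doubleSeries (hc : DiscSummable c) :
    Set.EqOn (dbar (doubleSeries c)) (doubleSeries (GenHarm.coeffDbar c)) disc :=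
  fun _ hz => dbar_eq_of_hasFDerivAt (hc.hasFDerivAt hz)

theorem contDiffOn_nat (hc : DiscSummable c) (n : ℕ) :
    ContDiffOn ℝ n (doubleSeries c) disc := by
  induction n generalizing c with
  | zero =>
    exact contDiffOn_zero.2 fun z hz => (hc.hasFDerivAt hz).continuousAt.continuousWithinAt
  | succ n ih =>
    exact contDiffOn_succ_of_hasFDerivAt_wirtinger (n := n) isOpen_disc
      (fun _ hz => hc.hasFDerivAt hz) (ih hc.coeffDz) (ih hc.coeffDbar)

theorem contDiffOn (hc : DiscSummable c) : ContDiffOn ℝ ∞ (doubleSeries c) disc :=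
  contDiffOn_infty.2 hc.contDiffOn_nat

theorem iterate_dbar_doubleSeries (hc : DiscSummable c) (l : ℕ) :
    Set.EqOn (dbar^[l] (doubleSeries c)) (doubleSeries (GenHarm.coeffDbar^[l] c)) disc := by
  induction l generalizing c with
  | zero => exact Set.eqOn_refl _ _
  | succ l ih =>
    exact (iterate_dbar_eqOn isOpen_disc hc.dbar_doubleSeries l).trans (ih hc.coeffDbar)

theorem iterate_dz_doubleSeries (hc : DiscSummable c) (j : ℕ) :
    Set.EqOn (dz^[j] (doubleSeries c)) (doubleSeries (GenHarm.coeffDz^[j] c)) disc := by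
  induction j generalizing c with
  | zero => exact Set.eqOn_refl _ _
  | succ j ih =>
    exact (iterate_dz_eqOn isOpen_disc hc.dz_doubleSeries j).trans (ih hc.coeffDz)

theorem iterate_dz_dbar_doubleSeries (hc : DiscSummable c) (j l : ℕ) :
    Set.EqOn (dz^[j] (dbar^[l] (doubleSeries c))) (doubleSeries (GenHarm.coeffDeriv j l c))
      disc :=
  (iterate_dz_eqOn isOpen_disc (hc.iterate_dbar_doubleSeries l) j).trans
    ((hc.iterate_coeffDbar l).iterate_dz_doubleSeries j)

theorem smoothSeminorm_indicator_le (hc : DiscSummable c) (j l : ℕ) (S : Set (ℕ × ℕ))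
    {K : Set ℂ} {R : ℝ} (hR : R ∈ Set.Ioo (0 : ℝ) 1) (hK : ∀ z ∈ K, ‖z‖ ≤ R) :
    smoothSeminorm j l K (doubleSeries (S.indicator c)) ≤
      ∑' i, ((fun i => (i.1 + j, i.2 + l)) ⁻¹' S).indicator
        (fun i => ‖GenHarm.coeffDeriv j l c i‖ * R ^ (i.1 + i.2)) i := by
  have hR0 := hR.1.le
  refine Real.iSup_le (fun z => ?_)
    (tsum_nonneg fun i => Set.indicator_nonneg (fun _ _ => by positivity) _)
  have hz : (z : ℂ) ∈ disc := mem_disc.2 ((hK z z.2).trans_lt hR.2)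
  rw [(hc.indicator S).iterate_dz_dbar_doubleSeries j l hz]
  refine (((hc.indicator S).coeffDeriv j l).norm_doubleSeries_le hR (hK z z.2)).trans_eq
    (tsum_congr fun i => ?_)
  rw [coeffDeriv_indicator, norm_indicator_eq_indicator_norm]
  exact (Set.indicator_mul_left _ _ fun i : ℕ × ℕ => R ^ (i.1 + i.2)).symm

theorem opM_doubleSeries {s t r : ℂ} (hc : DiscSummable c)
    (hrec : ∀ p q : ℕ, (p + 1) * (q + 1) * c (p + 1, q + 1) = (s * p + t * q + r) * c (p, q)) :
    Set.EqOn (opM s t r (doubleSeries c)) 0 disc := by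
  intro z hz
  have hdz : HasSum (fun i : ℕ × ℕ => s * i.1 * (c i * (z ^ i.1 * conj z ^ i.2)))
      (s * z * doubleSeries (GenHarm.coeffDz c) z) := by
    refine ((hc.hasSum_coeffDz hz).mul_left (s * z)).congr_fun fun ⟨p, q⟩ => ?_
    rcases p with _ | p
    · simp
    · simp only [Nat.add_sub_cancel]; ring
  have hdbar : HasSum (fun i : ℕ × ℕ => t * i.2 * (c i * (z ^ i.1 * conj z ^ i.2)))
      (t * conj z * doubleSeries (GenHarm.coeffDbar c) z) := by
    refine ((hc.hasSum_coeffDbar hz).mul_left (t * conj z)).congr_fun fun ⟨p, q⟩ => ?_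
    rcases q with _ | q
    · simp
    · simp only [Nat.add_sub_cancel]; ring
  have hsum := (((hc.coeffDbar.coeffDz.hasSum hz).sub hdz).sub hdbar).sub
    ((hc.hasSum hz).mul_left r)
  rw [opM, dz_eqOn isOpen_disc hc.dbar_doubleSeries hz, hc.coeffDbar.dz_doubleSeries hz,
    hc.dz_doubleSeries hz, hc.dbar_doubleSeries hz]
  refine hsum.unique (hasSum_zero.congr_fun fun ⟨p, q⟩ => ?_)
  simp only [GenHarm.coeffDz, GenHarm.coeffDbar, Nat.cast_add, Nat.cast_one]
  linear_combination (z ^ p * conj z ^ q) * hrec p q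

end DiscSummable

/-! ### Grouping the terms of a double series -/

theorem tendsto_tsum_indicator_preimage_compl {ι κ : Type*} {g : ι → ℝ} (hg : Summable g)
    (ρ : ι → κ) :
    Tendsto (fun F : Finset κ => ∑' i, (ρ ⁻¹' (F : Set κ)ᶜ).indicator g i) atTop (𝓝 0) := by
  rw [← tsum_zero (L := .unconditional ι)]
  refine tendsto_tsum_of_dominated_convergence hg.norm (fun i => ?_)
    (Eventually.of_forall fun F i => norm_indicator_le_norm_self _ _)
  refine tendsto_const_nhds.congr' ?_
  filter_upwards [eventually_ge_atTop {ρ i}] with F hF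
  exact (Set.indicator_of_notMem (by simpa using hF) _).symm

namespace DiscSummable

variable {c : ℕ × ℕ → ℂ}

theorem hasSum_fiberwise (hc : DiscSummable c) {κ : Type*} (π : ℕ × ℕ → κ) {z : ℂ}
    (hz : z ∈ disc) :
    HasSum (fun m => doubleSeries ((π ⁻¹' {m}).indicator c) z) (doubleSeries c z) := by
  refine ((hc.hasSum hz).tsum_fiberwise π).congr_fun fun m => ?_
  rw [tsum_subtype (π ⁻¹' {m}) fun i : ℕ × ℕ => c i * (z ^ i.1 * conj z ^ i.2)]
  exact tsum_congr fun i =>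
    (Set.indicator_mul_left _ c fun i : ℕ × ℕ => z ^ i.1 * conj z ^ i.2).symm

theorem absConvergent (hc : DiscSummable c) (π : ℕ × ℕ → ℤ) :
    AbsConvergent fun m => doubleSeries ((π ⁻¹' {m}).indicator c) := by
  refine ⟨fun m => (hc.indicator _).contDiffOn, fun j l K hK hKD => ?_⟩
  obtain ⟨R, hR, hKR⟩ := exists_norm_le_of_isCompact hK hKD
  refine (((hc.coeffDeriv j l R hR).hasSum.tsum_fiberwise
    fun i => π (i.1 + j, i.2 + l)).summable).of_nonneg_of_le
    (fun m => smoothSeminorm_nonneg _ _ _ _) fun m => ?_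
  rw [tsum_subtype ((fun i : ℕ × ℕ => π (i.1 + j, i.2 + l)) ⁻¹' {m})
    fun i => ‖GenHarm.coeffDeriv j l c i‖ * R ^ (i.1 + i.2)]
  exact hc.smoothSeminorm_indicator_le j l (π ⁻¹' {m}) hR hKR

theorem sum_sub_doubleSeries (hc : DiscSummable c) (π : ℕ × ℕ → ℤ) (F : Finset ℤ) {z : ℂ}
    (hz : z ∈ disc) :
    (∑ m ∈ F, doubleSeries ((π ⁻¹' {m}).indicator c) z) - doubleSeries c z =
      doubleSeries ((π ⁻¹' (F : Set ℤ)ᶜ).indicator (-c)) z := by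
  classical
  have hsum := (hasSum_sum fun m (_ : m ∈ F) => (hc.indicator (π ⁻¹' {m})).hasSum hz).sub
    (hc.hasSum hz)
  refine hsum.unique (((hc.neg.indicator _).hasSum hz).congr_fun fun i => ?_)
  by_cases h : π i ∈ F <;> simp [Set.indicator_apply, h]

theorem hasSmoothSum (hc : DiscSummable c) (π : ℕ × ℕ → ℤ) {u : ℂ → ℂ}
    (hu : Set.EqOn u (doubleSeries c) disc) :
    HasSmoothSum (fun m => doubleSeries ((π ⁻¹' {m}).indicator c)) u := by
  refine ⟨hc.contDiffOn.congr hu, fun j l K hK hKD => ?_⟩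
  obtain ⟨R, hR, hKR⟩ := exists_norm_le_of_isCompact hK hKD
  refine squeeze_zero (fun F => smoothSeminorm_nonneg _ _ _ _) (fun F => ?_)
    (tendsto_tsum_indicator_preimage_compl (hc.neg.coeffDeriv j l R hR)
      fun i => π (i.1 + j, i.2 + l))
  rw [smoothSeminorm_congr hKD (fun z hz => (congrArg _ (hu hz)).trans
    (hc.sum_sub_doubleSeries π F hz))]
  exact hc.neg.smoothSeminorm_indicator_le j l _ hR hKR

end DiscSummable

/-! ### The root condition -/

theorem summable_pow_natAbs {q : ℝ} (h0 : 0 ≤ q) (h1 : q < 1) :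
    Summable fun m : ℤ => q ^ m.natAbs := by
  refine summable_int_iff_summable_nat_and_neg.2 ⟨?_, ?_⟩ <;>
  simpa using summable_geometric_of_lt_one h0 h1

theorem enorm_rpow_one_div_le_iff {a : ℂ} {R : ℝ} (hR : 0 < R) {n : ℕ} (hn : n ≠ 0) :
    ‖a‖ₑ ^ (1 / (n : ℝ)) ≤ ENNReal.ofReal R⁻¹ ↔ ‖a‖ * R ^ n ≤ 1 := by
  rw [one_div, ENNReal.rpow_inv_le_iff (by positivity), ENNReal.rpow_natCast,
    ← ENNReal.ofReal_pow (by positivity), ← ofReal_norm,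
    ENNReal.ofReal_le_ofReal_iff (by positivity), inv_pow, ← one_div,
    le_div_iff₀ (by positivity)]

theorem rootCondition_iff {k : ℤ → ℂ} :
    RootCondition k ↔
      ∀ R ∈ Set.Ioo (0 : ℝ) 1, ∀ᶠ m in cofinite, ‖k m‖ * R ^ m.natAbs ≤ 1 := by
  have hfilter : comap (fun m : ℤ => |m|) atTop = cofinite := by
    rw [Int.cofinite_eq]; exact comap_abs_atTop
  have hne : ∀ᶠ m : ℤ in cofinite, m.natAbs ≠ 0 := by
    filter_upwards [(Set.finite_singleton (0 : ℤ)).compl_mem_cofinite] with m hm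
    exact Int.natAbs_ne_zero.2 hm
  rw [RootCondition, hfilter, limsup_le_iff]
  constructor
  · intro h R hR
    have hlt : 1 < ENNReal.ofReal R⁻¹ := ENNReal.one_lt_ofReal.2 ((one_lt_inv₀ hR.1).2 hR.2)
    filter_upwards [h _ hlt, hne] with m hm hm0
    exact (enorm_rpow_one_div_le_iff hR.1 hm0).1 hm.le
  · intro h y hy
    obtain ⟨ρ, -, h1ρ, hρy⟩ := ENNReal.lt_iff_exists_real_btwn.1 hy
    have hρ : 1 < ρ := ENNReal.one_lt_ofReal.1 h1ρ
    have hρ0 : 0 < ρ := one_pos.trans hρ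
    filter_upwards [h ρ⁻¹ ⟨inv_pos.2 hρ0, inv_lt_one_of_one_lt₀ hρ⟩, hne] with m hm hm0
    refine ((enorm_rpow_one_div_le_iff (inv_pos.2 hρ0) hm0).2 hm).trans_lt ?_
    rwa [inv_inv]

theorem rootCondition_one : RootCondition 1 := rootCondition_iff.2 fun R hR =>
  Eventually.of_forall fun m => by simpa using pow_le_one₀ hR.1.le hR.2.le

theorem RootCondition.summable {k : ℤ → ℂ} (hk : RootCondition k) {R : ℝ}
    (hR : R ∈ Set.Ioo (0 : ℝ) 1) : Summable fun m : ℤ => ‖k m‖ * R ^ m.natAbs := by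
  obtain ⟨S, hRS, hS1⟩ := exists_between hR.2
  have hR0 := hR.1
  have hS : 0 < S := hR0.trans hRS
  refine Summable.of_norm_bounded_eventually
    (summable_pow_natAbs (q := R / S) (by positivity) ((div_lt_one hS).2 hRS)) ?_
  filter_upwards [rootCondition_iff.1 hk S ⟨hS, hS1⟩] with m hm
  rw [Real.norm_of_nonneg (by positivity)]
  calc ‖k m‖ * R ^ m.natAbs = ‖k m‖ * S ^ m.natAbs * (R / S) ^ m.natAbs := by
        rw [div_pow]; field_simp
    _ ≤ 1 * (R / S) ^ m.natAbs := by gcongr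
    _ = _ := one_mul _

theorem rootCondition_of_eventually_le {k : ℤ → ℂ}
    (h : ∀ R ∈ Set.Ioo (0 : ℝ) 1, ∃ C : ℝ, ∀ᶠ m in cofinite, ‖k m‖ * R ^ m.natAbs ≤ C) :
    RootCondition k := by
  refine rootCondition_iff.2 fun R hR => ?_
  obtain ⟨S, hRS, hS1⟩ := exists_between hR.2
  have hR0 := hR.1
  have hS : 0 < S := hR0.trans hRS
  obtain ⟨C, hC⟩ := h S ⟨hS, hS1⟩
  have hlim := (summable_pow_natAbs (q := R / S) (by positivity)
    ((div_lt_one hS).2 hRS)).tendsto_cofinite_zero.const_mul C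
  rw [mul_zero] at hlim
  filter_upwards [hC, hlim.eventually_le_const one_pos] with m hm hm1
  calc ‖k m‖ * R ^ m.natAbs = ‖k m‖ * S ^ m.natAbs * (R / S) ^ m.natAbs := by
        rw [div_pow]; field_simp
    _ ≤ C * (R / S) ^ m.natAbs := by gcongr
    _ ≤ 1 := hm1

/-! ### The hypergeometric-type functions `𝒫` -/

section CalP

variable {α β γ : ℂ} {A : ℝ}

theorem poch_succ (x y : ℂ) (n : ℕ) : poch x y (n + 1) = poch x y n * (x + n * y) :=
  Finset.prod_range_succ _ n

theorem poch_div_poch_one (α β γ : ℂ) (n : ℕ) :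
    poch α β n / poch γ 1 n = ∏ i ∈ Finset.range n, (α + i * β) / (γ + i) := by
  simp only [poch, mul_one, Finset.prod_div_distrib]

theorem norm_poch_div_poch_one_le (hA : 0 ≤ A) (h : ∀ i : ℕ, ‖α + i * β‖ ≤ A * ‖γ + i‖) (n : ℕ) :
    ‖poch α β n / poch γ 1 n‖ ≤ A ^ n := by
  rw [poch_div_poch_one, norm_prod, ← Finset.card_range n, ← Finset.prod_const,
    Finset.card_range]
  refine Finset.prod_le_prod (fun i _ => norm_nonneg _) fun i _ => ?_
  rw [norm_div]
  exact div_le_of_le_mul₀ (norm_nonneg _) hA (h i)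

theorem norm_calP_summand_le (hA : 0 ≤ A) (h : ∀ i : ℕ, ‖α + i * β‖ ≤ A * ‖γ + i‖) (x : ℂ)
    (n : ℕ) :
    ‖poch α β n / poch γ 1 n * (x ^ n / (n.factorial : ℂ))‖ ≤ (A * ‖x‖) ^ n / n.factorial := by
  rw [norm_mul, norm_div (x ^ n), norm_pow, Complex.norm_natCast, mul_pow, mul_div_assoc]
  exact mul_le_mul_of_nonneg_right (norm_poch_div_poch_one_le hA h n) (by positivity)

theorem calP_zero (α β γ : ℂ) : calP α β γ 0 = 1 := by
  rw [calP, tsum_eq_single 0 fun n hn => by simp [hn]]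
  simp [poch]

theorem tendsto_calP_nhds_zero (hA : 0 ≤ A) (h : ∀ i : ℕ, ‖α + i * β‖ ≤ A * ‖γ + i‖) :
    Tendsto (calP α β γ) (𝓝 0) (𝓝 1) := by
  rw [← calP_zero α β γ]
  refine tendsto_tsum_of_dominated_convergence (Real.summable_pow_div_factorial A)
    (fun n => (Continuous.tendsto (by fun_prop) 0)) ?_
  filter_upwards [Metric.ball_mem_nhds (0 : ℂ) one_pos] with x hx n
  refine (norm_calP_summand_le hA h x n).trans ?_
  gcongr
  exact mul_le_of_le_one_right hA (mem_ball_zero_iff.1 hx).le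

theorem norm_add_mul_natCast_add_mul_natCast_le (a b c : ℂ) {p q N : ℕ} (hN : 1 ≤ N)
    (hp : p ≤ N) (hq : q ≤ N) :
    ‖a + b * p + c * q‖ ≤ (‖a‖ + ‖b‖ + ‖c‖) * ‖(N : ℂ)‖ := by
  have hN' : (1 : ℝ) ≤ N := Nat.one_le_cast.2 hN
  calc ‖a + b * p + c * q‖ ≤ ‖a‖ + ‖b‖ * p + ‖c‖ * q := by
        refine norm_add₃_le.trans_eq ?_
        simp only [norm_mul, Complex.norm_natCast]
    _ ≤ ‖a‖ * N + ‖b‖ * N + ‖c‖ * N := by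
        gcongr
        exact le_mul_of_one_le_right (norm_nonneg a) hN'
    _ = _ := by rw [Complex.norm_natCast]; ring

theorem tendsto_calP_atTop (a b β x : ℂ) :
    Tendsto (fun m : ℕ => calP (a + b * m) β (m + 1) x) atTop (𝓝 (Complex.exp (b * x))) := by
  have hfactor (i : ℕ) : Tendsto (fun m : ℕ => (a + b * m + i * β) / (m + 1 + i : ℂ)) atTop
      (𝓝 b) := by
    have hinv : Tendsto (fun m : ℕ => ((m + (1 + i) : ℕ) : ℂ)⁻¹) atTop (𝓝 0) :=
      (tendsto_inv_atTop_nhds_zero_nat (𝕜 := ℂ)).comp (tendsto_add_atTop_nat (1 + i))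
    have hlim := (hinv.const_mul (a + i * β - b * (1 + i))).const_add b
    rw [mul_zero, add_zero] at hlim
    refine hlim.congr fun m => ?_
    have hm : (m + 1 + i : ℂ) ≠ 0 := by exact_mod_cast (by omega : m + 1 + i ≠ 0)
    push_cast
    rw [← add_assoc]
    field_simp
    ring
  have hbound (m i : ℕ) : ‖a + b * m + i * β‖ ≤ (‖a‖ + ‖b‖ + ‖β‖) * ‖(m + 1 + i : ℂ)‖ := by
    have h := norm_add_mul_natCast_add_mul_natCast_le a b β (N := m + 1 + i) (p := m) (q := i)
      (by omega) (by omega) (by omega)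
    rw [mul_comm (i : ℂ)]
    exact_mod_cast h
  rw [Complex.exp_eq_exp_ℂ, NormedSpace.exp_eq_tsum_div]
  refine tendsto_tsum_of_dominated_convergence
    (Real.summable_pow_div_factorial ((‖a‖ + ‖b‖ + ‖β‖) * ‖x‖)) (fun n => ?_)
    (Eventually.of_forall fun m =>
      norm_calP_summand_le (by positivity) (hbound m) x)
  have hprod : Tendsto (fun m : ℕ => poch (a + b * m) β n / poch (m + 1 : ℂ) 1 n) atTop
      (𝓝 (b ^ n)) := by
    simp only [poch_div_poch_one]
    simpa using tendsto_finsetProd (Finset.range n) fun i _ => hfactor i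
  rw [mul_pow, mul_div_assoc]
  exact hprod.mul_const _

end CalP

/-! ### The coefficients of the expansion -/

/-- The degree of homogeneity of the monomial `z^p z̄^q` under rotations. -/
def weight (i : ℕ × ℕ) : ℤ := i.1 - i.2

theorem weight_succ_succ (p q : ℕ) : weight (p + 1, q + 1) = weight (p, q) := by
  simp [weight]

/-- The coefficient of `x^n` in `𝒫(r + sm, s + t | m + 1; x)` if `m ≥ 0`, and in
`𝒫(r + t|m|, s + t | |m| + 1; x)` if `m < 0`. The two cases are merged by means of the positive
and negative parts of `m`. -/
def hypCoeff (s t r : ℂ) (m : ℤ) (n : ℕ) : ℂ :=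
  poch (r + s * m.toNat + t * (-m).toNat) (s + t) n / poch (m.natAbs + 1) 1 n / n.factorial

/-- The coefficient of `z^p z̄^q` in `∑ m, term s t r k m z`. -/
def expCoeff (s t r : ℂ) (k : ℤ → ℂ) (i : ℕ × ℕ) : ℂ :=
  k (weight i) * hypCoeff s t r (weight i) (min i.1 i.2)

section Coefficients

variable (s t r : ℂ)

theorem term_eq (k : ℤ → ℂ) (m : ℤ) (z : ℂ) :
    term s t r k m z =
      k m * calP (r + s * m.toNat + t * (-m).toNat) (s + t) (m.natAbs + 1) (z * conj z) *
        (z ^ m.toNat * conj z ^ (-m).toNat) := by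
  rw [Complex.mul_conj', term]
  split_ifs with hm
  · rw [show (-m).toNat = 0 by omega, show m.natAbs = m.toNat by omega]
    simp
  · rw [show m.toNat = 0 by omega, show m.natAbs = (-m).toNat by omega, add_comm t s]
    simp

theorem norm_parameter_le (m : ℤ) (i : ℕ) :
    ‖r + s * m.toNat + t * (-m).toNat + i * (s + t)‖ ≤
      (‖r‖ + ‖s‖ + ‖t‖) * ‖(m.natAbs + 1 + i : ℂ)‖ := by
  have h := norm_add_mul_natCast_add_mul_natCast_le r s t (N := m.natAbs + 1 + i)
    (p := m.toNat + i) (q := (-m).toNat + i) (by omega) (by omega) (by omega)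
  push_cast at h
  convert h using 2
  ring

theorem norm_hypCoeff_le (m : ℤ) (n : ℕ) :
    ‖hypCoeff s t r m n‖ ≤ (‖r‖ + ‖s‖ + ‖t‖) ^ n / n.factorial := by
  rw [hypCoeff, norm_div, Complex.norm_natCast]
  gcongr
  exact norm_poch_div_poch_one_le (by positivity) (norm_parameter_le s t r m) n

theorem hypCoeff_succ (m : ℤ) (n : ℕ) :
    (m.natAbs + n + 1) * (n + 1) * hypCoeff s t r m (n + 1) =
      (s * (m.toNat + n) + t * ((-m).toNat + n) + r) * hypCoeff s t r m n := by
  have hm : (m.natAbs + 1 + n : ℂ) ≠ 0 := by exact_mod_cast (by omega : m.natAbs + 1 + n ≠ 0)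
  have hn : (n + 1 : ℂ) ≠ 0 := n.cast_add_one_ne_zero
  simp only [hypCoeff, poch_succ, mul_one, Nat.factorial_succ, Nat.cast_mul, Nat.cast_succ,
    div_eq_mul_inv, mul_inv]
  field_simp
  ring

theorem expCoeff_succ (k : ℤ → ℂ) (p q : ℕ) :
    (p + 1) * (q + 1) * expCoeff s t r k (p + 1, q + 1) =
      (s * p + t * q + r) * expCoeff s t r k (p, q) := by
  have hp : (p : ℂ) = (weight (p, q)).toNat + (min p q : ℕ) := by
    exact_mod_cast (by simp only [weight]; omega)
  have hq : (q : ℂ) = (-weight (p, q)).toNat + (min p q : ℕ) := by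
    exact_mod_cast (by simp only [weight]; omega)
  have hpq : ((p + 1) * (q + 1) : ℂ) =
      ((weight (p, q)).natAbs + (min p q : ℕ) + 1) * ((min p q : ℕ) + 1) := by
    have hnat : (p + 1) * (q + 1) = ((weight (p, q)).natAbs + min p q + 1) * (min p q + 1) := by
      rcases le_total p q with h | h
      · rw [min_eq_left h, mul_comm, show (weight (p, q)).natAbs + p = q by
          simp only [weight]; omega]
      · rw [min_eq_right h, show (weight (p, q)).natAbs + q = p by simp only [weight]; omega]
    exact_mod_cast hnat
  have hrec := hypCoeff_succ s t r (weight (p, q)) (min p q)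
  simp only [expCoeff, weight_succ_succ, Nat.succ_min_succ, ← hp, ← hq, ← hpq] at hrec ⊢
  linear_combination k (weight (p, q)) * hrec

theorem injective_weight_min : Function.Injective fun i : ℕ × ℕ => (weight i, min i.1 i.2) := by
  rintro ⟨p, q⟩ ⟨p', q'⟩ h
  simp only [weight, Prod.mk.injEq] at h ⊢
  omega

theorem RootCondition.discSummable_expCoeff {k : ℤ → ℂ} (hk : RootCondition k) :
    DiscSummable (expCoeff s t r k) := by
  intro R hR
  have hR0 := hR.1.le
  have hsum := ((hk.summable hR).mul_of_nonneg
    (Real.summable_pow_div_factorial (‖r‖ + ‖s‖ + ‖t‖)) (fun _ => by positivity)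
    (fun _ => by positivity)).comp_injective injective_weight_min
  refine hsum.of_nonneg_of_le (fun i => by positivity) fun i => ?_
  have hpow : R ^ (i.1 + i.2) ≤ R ^ (weight i).natAbs :=
    pow_le_pow_of_le_one hR0 hR.2.le (by simp only [weight]; omega)
  calc ‖expCoeff s t r k i‖ * R ^ (i.1 + i.2)
      ≤ ‖k (weight i)‖ * ((‖r‖ + ‖s‖ + ‖t‖) ^ (min i.1 i.2) / (min i.1 i.2).factorial) *
        R ^ (weight i).natAbs := by
        rw [expCoeff, norm_mul]
        gcongr
        exact norm_hypCoeff_le _ _ _ _ _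
    _ = _ := by simp only [Function.comp]; ring

theorem term_eq_doubleSeries (k : ℤ → ℂ) (m : ℤ) :
    term s t r k m = doubleSeries ((weight ⁻¹' {m}).indicator (expCoeff s t r k)) := by
  funext z
  have hinj : Function.Injective fun n : ℕ => (m.toNat + n, (-m).toNat + n) :=
    fun a b h => by simpa using h
  rw [doubleSeries, ← hinj.tsum_eq, term_eq, calP, ← tsum_mul_left, ← tsum_mul_right]
  · refine tsum_congr fun n => ?_
    have hweight : weight (m.toNat + n, (-m).toNat + n) = m := by simp only [weight]; omega
    have hmin : min (m.toNat + n) ((-m).toNat + n) = n := by omega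
    rw [Set.indicator_of_mem (by exact hweight), expCoeff, hweight, hmin, hypCoeff]
    ring
  · rintro ⟨p, q⟩ h
    have hweight : weight (p, q) = m := by
      by_contra hne
      exact h (by simp [hne])
    exact ⟨min p q, by simp only [weight] at hweight; simp only [Prod.mk.injEq]; omega⟩

theorem RootCondition.hasSum_term {k : ℤ → ℂ} (hk : RootCondition k) {z : ℂ} (hz : z ∈ disc) :
    HasSum (fun m => term s t r k m z) (doubleSeries (expCoeff s t r k) z) := by
  simpa only [term_eq_doubleSeries] using
    (hk.discSummable_expCoeff s t r).hasSum_fiberwise weight hz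

theorem RootCondition.isSolution_doubleSeries {k : ℤ → ℂ} (hk : RootCondition k) :
    IsSolution s t r (doubleSeries (expCoeff s t r k)) :=
  ⟨(hk.discSummable_expCoeff s t r).contDiffOn_nat 2,
    (hk.discSummable_expCoeff s t r).opM_doubleSeries (expCoeff_succ s t r k)⟩

end Coefficients

/-! ### Decomposition into weight components -/

section Rotation

variable {f : ℂ → ℂ} {z : ℂ}

theorem circle_mul_conj (a : Circle) : (a : ℂ) * conj (a : ℂ) = 1 := by simp [Complex.mul_conj]

theorem circle_mul_mem_disc (a : Circle) : a * z ∈ disc ↔ z ∈ disc := by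
  simp only [mem_disc, norm_mul, Circle.norm_coe, one_mul]

theorem continuous_rotate (hf : ContinuousOn f disc) (hz : z ∈ disc) :
    Continuous fun θ : UnitAddCircle => f (θ.toCircle * z) :=
  hf.comp_continuous (by fun_prop) fun θ => (circle_mul_mem_disc θ.toCircle).2 hz

theorem integrable_rotate (hf : ContinuousOn f disc) (hz : z ∈ disc) :
    Integrable (fun θ : UnitAddCircle => f (θ.toCircle * z)) AddCircle.haarAddCircle :=
  (continuous_rotate hf hz).integrable_of_hasCompactSupport (HasCompactSupport.of_compactSpace _)

theorem hasFDerivAt_comp_mul_left (a : ℂ) (hf : DifferentiableAt ℝ f (a * z)) :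
    HasFDerivAt (fun w => f (a * w))
      (wirtinger (a * dz f (a * z)) (conj a * dbar f (a * z))) z := by
  refine ((hasFDerivAt_wirtinger hf).comp z ((hasFDerivAt_id z).const_mul a)).congr_fderiv ?_
  refine ContinuousLinearMap.ext fun w => ?_
  simp only [ContinuousLinearMap.comp_apply, wirtinger_apply, smul_apply,
    ContinuousLinearMap.id_apply, smul_eq_mul, map_mul]
  ring

theorem exists_norm_le_of_continuousOn {R : ℝ} (hf : ContinuousOn f disc) (hR : R < 1) :
    ∃ C, ∀ z : ℂ, ‖z‖ ≤ R → ‖f z‖ ≤ C := by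
  obtain ⟨C, hC⟩ := (isCompact_closedBall (0 : ℂ) R).exists_bound_of_continuousOn
    (hf.mono (Metric.closedBall_subset_ball hR))
  exact ⟨C, fun z hz => hC z (mem_closedBall_zero_iff.2 hz)⟩

end Rotation

theorem integrable_wirtinger {α : Type*} [MeasurableSpace α] {μ : Measure α} {p q : α → ℂ}
    (hp : Integrable p μ) (hq : Integrable q μ) : Integrable (fun x => wirtinger (p x) (q x)) μ :=
  Integrable.add (ε' := ℂ →L[ℝ] ℂ) (hp.smul_const _) (hq.smul_const _)

theorem integral_wirtinger {α : Type*} [MeasurableSpace α] {μ : Measure α} {p q : α → ℂ}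
    (hp : Integrable p μ) (hq : Integrable q μ) :
    ∫ x, wirtinger (p x) (q x) ∂μ = wirtinger (∫ x, p x ∂μ) (∫ x, q x ∂μ) :=
  (integral_add (hp.smul_const _) (hq.smul_const _)).trans
    (congrArg₂ (· + ·) (integral_smul_const p _) (integral_smul_const q _))

/-- `f` is homogeneous of degree `m` under the rotations of the disc. -/
def HasWeight (m : ℤ) (f : ℂ → ℂ) : Prop :=
  ∀ a : Circle, ∀ z ∈ disc, f (a * z) = (a : ℂ) ^ m * f z

/-- The component of weight `m` of `f`: its value at `z` is the `m`-th Fourier coefficient of the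
restriction of `f` to the circle through `z` centred at the origin, parametrised from `z` on. -/
def weightPart (m : ℤ) (f : ℂ → ℂ) (z : ℂ) : ℂ :=
  fourierCoeff (fun θ : UnitAddCircle => f (θ.toCircle * z)) m

section WeightPart

variable {f g : ℂ → ℂ} {z : ℂ}

theorem hasWeight_weightPart (m : ℤ) (f : ℂ → ℂ) : HasWeight m (weightPart m f) := by
  intro a z _
  obtain ⟨φ, rfl⟩ := (AddCircle.homeomorphCircle one_ne_zero).surjective a
  rw [AddCircle.homeomorphCircle_apply, weightPart, weightPart, fourierCoeff, fourierCoeff,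
    ← integral_const_mul]
  refine Eq.trans ?_ (integral_add_right_eq_self _ φ)
  refine integral_congr_ae (Eventually.of_forall fun θ => ?_)
  have hφ : (φ.toCircle : ℂ) ≠ 0 := Circle.coe_ne_zero _
  simp only [fourier_apply, smul_add, AddCircle.toCircle_add, AddCircle.toCircle_zsmul,
    Circle.coe_mul, Circle.coe_zpow, Circle.coe_inv, smul_eq_mul, zpow_neg, mul_assoc]
  field_simp

theorem norm_weightPart_le {C : ℝ} (m : ℤ) (h : ∀ w, ‖w‖ = ‖z‖ → ‖f w‖ ≤ C) :
    ‖weightPart m f z‖ ≤ C := by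
  refine (norm_integral_le_of_norm_le_const (C := C) (Eventually.of_forall fun θ => ?_)).trans ?_
  · rw [norm_smul, fourier_apply, Circle.norm_coe, one_mul]
    exact h _ (by rw [norm_mul, Circle.norm_coe, one_mul])
  · simp

theorem weightPart_congr (m : ℤ) (h : Set.EqOn f g disc) (hz : z ∈ disc) :
    weightPart m f z = weightPart m g z := by
  simp only [weightPart, h ((circle_mul_mem_disc _).2 hz)]

theorem weightPart_const_mul (m : ℤ) (c : ℂ) (f : ℂ → ℂ) (z : ℂ) :
    weightPart m (fun w => c * f w) z = c * weightPart m f z :=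
  fourierCoeff.const_mul _ c m

theorem weightPart_add (m : ℤ) (hf : ContinuousOn f disc) (hg : ContinuousOn g disc)
    (hz : z ∈ disc) :
    weightPart m (fun w => f w + g w) z = weightPart m f z + weightPart m g z :=
  congrFun (fourierCoeff.add (integrable_rotate hf hz) (integrable_rotate hg hz)) m

theorem weightPart_id_mul (m : ℤ) (f : ℂ → ℂ) (z : ℂ) :
    weightPart m (fun w => w * f w) z = z * weightPart (m - 1) f z := by
  rw [weightPart, weightPart, fourierCoeff, fourierCoeff, ← integral_const_mul]
  refine integral_congr_ae (Eventually.of_forall fun θ => ?_)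
  simp only [neg_sub, sub_eq_add_neg 1 m, fourier_add, fourier_one, smul_eq_mul]
  ring

theorem weightPart_conj_mul (m : ℤ) (f : ℂ → ℂ) (z : ℂ) :
    weightPart m (fun w => conj w * f w) z = conj z * weightPart (m + 1) f z := by
  rw [weightPart, weightPart, fourierCoeff, fourierCoeff, ← integral_const_mul]
  refine integral_congr_ae (Eventually.of_forall fun θ => ?_)
  simp only [neg_add m, fourier_add, fourier_neg (n := 1), fourier_one, smul_eq_mul, map_mul]
  ring

theorem continuousOn_weightPart (m : ℤ) (hf : ContinuousOn f disc) :
    ContinuousOn (weightPart m f) disc := by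
  refine continuousOn_integral_of_compact_support isCompact_univ ?_
    fun _ _ _ h => (h trivial).elim
  have hrotate : ContinuousOn (fun p : ℂ × UnitAddCircle => f (p.2.toCircle * p.1))
      (disc ×ˢ Set.univ) :=
    hf.comp (by fun_prop) fun p hp => (circle_mul_mem_disc p.2.toCircle).2 hp.1
  have hchar : Continuous fun p : ℂ × UnitAddCircle => fourier (-m) p.2 := by fun_prop
  exact hchar.continuousOn.smul hrotate

theorem hasFDerivAt_fourier_smul_rotate (m : ℤ) (θ : UnitAddCircle)
    (hf : DifferentiableAt ℝ f (θ.toCircle * z)) :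
    HasFDerivAt (fun w => fourier (-m) θ • f (θ.toCircle * w))
      (wirtinger (fourier (-(m - 1)) θ • dz f (θ.toCircle * z))
        (fourier (-(m + 1)) θ • dbar f (θ.toCircle * z))) z := by
  refine ((hasFDerivAt_comp_mul_left _ hf).const_smul (fourier (-m) θ)).congr_fderiv ?_
  refine ContinuousLinearMap.ext fun w => ?_
  simp only [neg_sub, sub_eq_add_neg 1 m, neg_add m, fourier_add, fourier_neg (n := 1),
    fourier_one, smul_apply, wirtinger_apply, smul_eq_mul]
  ring

theorem hasFDerivAt_weightPart (m : ℤ) (hf : ContDiffOn ℝ 1 f disc) (hz : z ∈ disc) :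
    HasFDerivAt (weightPart m f)
      (wirtinger (weightPart (m - 1) (dz f) z) (weightPart (m + 1) (dbar f) z)) z := by
  have hdz : ContinuousOn (dz f) disc := (contDiffOn_dz (n := 0) isOpen_disc hf).continuousOn
  have hdbar : ContinuousOn (dbar f) disc :=
    (contDiffOn_dbar (n := 0) isOpen_disc hf).continuousOn
  obtain ⟨R, hzR, hR⟩ := exists_between (mem_disc.1 hz)
  obtain ⟨A, hA⟩ := exists_norm_le_of_continuousOn hdz hR
  obtain ⟨B, hB⟩ := exists_norm_le_of_continuousOn hdbar hR
  have hint (n : ℤ) {g : ℂ → ℂ} (hg : ContinuousOn g disc) {w : ℂ} (hw : w ∈ disc) :=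
    (integrable_rotate hg hw).fourier_smul n
  have hball : Metric.ball (0 : ℂ) R ∈ 𝓝 z := Metric.isOpen_ball.mem_nhds (by simpa using hzR)
  have hdz_int := hint (-(m - 1)) hdz hz
  have hdbar_int := hint (-(m + 1)) hdbar hz
  rw [weightPart, weightPart, fourierCoeff, fourierCoeff, ← integral_wirtinger hdz_int hdbar_int]
  refine hasFDerivAt_integral_of_dominated_of_fderiv_le (s := Metric.ball 0 R)
    (bound := fun _ => A + B)
    (F' := fun w θ => wirtinger (fourier (-(m - 1)) θ • dz f (θ.toCircle * w))
      (fourier (-(m + 1)) θ • dbar f (θ.toCircle * w))) hball ?_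
    (hint (-m) hf.continuousOn hz) (integrable_wirtinger hdz_int hdbar_int).aestronglyMeasurable
    ?_ (integrable_const _) ?_
  · filter_upwards [isOpen_disc.mem_nhds hz] with w hw
    exact (hint (-m) hf.continuousOn hw).aestronglyMeasurable
  · refine Eventually.of_forall fun θ w hw => (norm_wirtinger_le _ _).trans ?_
    have hwR : ‖(θ.toCircle * w : ℂ)‖ ≤ R := by
      simpa only [norm_mul, Circle.norm_coe, one_mul] using (mem_ball_zero_iff.1 hw).le
    simp only [norm_smul, fourier_apply, Circle.norm_coe, one_mul]
    exact add_le_add (hA _ hwR) (hB _ hwR)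
  · refine Eventually.of_forall fun θ w hw => hasFDerivAt_fourier_smul_rotate m θ ?_
    have hwD : (θ.toCircle * w : ℂ) ∈ disc :=
      (circle_mul_mem_disc _).2 (mem_disc.2 ((mem_ball_zero_iff.1 hw).trans hR))
    exact (hf.differentiableOn one_ne_zero).differentiableAt (isOpen_disc.mem_nhds hwD)

theorem dz_weightPart (m : ℤ) (hf : ContDiffOn ℝ 1 f disc) :
    Set.EqOn (dz (weightPart m f)) (weightPart (m - 1) (dz f)) disc :=
  fun _ hz => dz_eq_of_hasFDerivAt (hasFDerivAt_weightPart m hf hz)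

theorem dbar_weightPart (m : ℤ) (hf : ContDiffOn ℝ 1 f disc) :
    Set.EqOn (dbar (weightPart m f)) (weightPart (m + 1) (dbar f)) disc :=
  fun _ hz => dbar_eq_of_hasFDerivAt (hasFDerivAt_weightPart m hf hz)

theorem contDiffOn_weightPart (n : ℕ) (m : ℤ) (hf : ContDiffOn ℝ n f disc) :
    ContDiffOn ℝ n (weightPart m f) disc := by
  induction n generalizing m f with
  | zero => exact contDiffOn_zero.2 (continuousOn_weightPart m hf.continuousOn)
  | succ n ih =>
    have hf1 : ContDiffOn ℝ 1 f disc := hf.of_le (by norm_cast; omega)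
    exact contDiffOn_succ_of_hasFDerivAt_wirtinger (n := n) isOpen_disc
      (fun z hz => hasFDerivAt_weightPart m hf1 hz)
      (ih _ (contDiffOn_dz (n := n) isOpen_disc hf))
      (ih _ (contDiffOn_dbar (n := n) isOpen_disc hf))

theorem hasSum_weightPart (hf : ContinuousOn f disc) (hz : z ∈ disc)
    (h : Summable fun m => weightPart m f z) : HasSum (fun m => weightPart m f z) (f z) := by
  have hsum := has_pointwise_sum_fourier_series_of_summable
    (f := ⟨_, continuous_rotate hf hz⟩) h 0
  simpa [weightPart] using hsum

theorem opM_weightPart (s t r : ℂ) (m : ℤ) (hf : ContDiffOn ℝ 2 f disc) :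
    Set.EqOn (opM s t r (weightPart m f)) (weightPart m (opM s t r f)) disc := by
  have hf1 : ContDiffOn ℝ 1 f disc := hf.of_le one_le_two
  have hdz : ContinuousOn (dz f) disc := (contDiffOn_dz (n := 0) isOpen_disc hf1).continuousOn
  have hdbar : ContDiffOn ℝ 1 (dbar f) disc := contDiffOn_dbar (n := 1) isOpen_disc hf
  have hdzdbar : ContinuousOn (dz (dbar f)) disc :=
    (contDiffOn_dz (n := 0) isOpen_disc hdbar).continuousOn
  have hopM : opM s t r f = fun w => dz (dbar f) w + (-s) * (w * dz f w) +
      (-t) * (conj w * dbar f w) + (-r) * f w := by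
    funext w
    rw [opM]
    ring
  have hconj : ContinuousOn (fun w : ℂ => conj w) disc := by fun_prop
  have hf0 := hf.continuousOn
  have hdbar0 := hdbar.continuousOn
  intro z hz
  have hsecond : dz (dbar (weightPart m f)) z = weightPart m (dz (dbar f)) z := by
    rw [dz_eqOn isOpen_disc (dbar_weightPart m hf1) hz, dz_weightPart _ hdbar hz,
      add_sub_cancel_right]
  rw [hopM, weightPart_add, weightPart_add, weightPart_add, weightPart_const_mul,
    weightPart_const_mul, weightPart_const_mul, weightPart_id_mul, weightPart_conj_mul, opM,
    hsecond, dz_weightPart m hf1 hz, dbar_weightPart m hf1 hz]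
  · ring
  all_goals first | exact hz | fun_prop

protected theorem IsSolution.weightPart {s t r : ℂ} (hf : IsSolution s t r f) (m : ℤ) :
    IsSolution s t r (weightPart m f) := by
  refine ⟨contDiffOn_weightPart 2 m hf.1, fun z hz => ?_⟩
  rw [opM_weightPart s t r m hf.1 hz, weightPart_congr (g := fun w => 0 * f w) m
    (fun w hw => (hf.2 w hw).trans (zero_mul _).symm) hz, weightPart_const_mul, zero_mul]

end WeightPart

/-! ### Solutions of a given weight -/

section HasWeight

variable {m : ℤ} {f g : ℂ → ℂ} {z : ℂ}

theorem HasWeight.const_mul (c : ℂ) (hf : HasWeight m f) : HasWeight m fun z => c * f z :=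
  fun a z hz => (congrArg (c * ·) (hf a z hz)).trans (mul_left_comm _ _ _)

theorem HasWeight.eqOn (hf : HasWeight m f) (hg : HasWeight m g) (hfc : ContinuousOn f disc)
    (hgc : ContinuousOn g disc) (h : ∀ x ∈ Set.Ioo (0 : ℝ) 1, f x = g x) : Set.EqOn f g disc := by
  have hpunctured : Set.EqOn f g (disc ∩ {0}ᶜ) := fun z hz => by
    have hnorm : ‖z‖ ∈ Set.Ioo (0 : ℝ) 1 := ⟨norm_pos_iff.2 hz.2, mem_disc.1 hz.1⟩
    have hz' : (Circle.exp z.arg * ‖z‖ : ℂ) = z := by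
      rw [Circle.coe_exp, mul_comm, Complex.norm_mul_exp_arg_mul_I]
    rw [← hz', hf _ _ (ofReal_mem_disc hnorm), hg _ _ (ofReal_mem_disc hnorm), h _ hnorm]
  exact hpunctured.of_subset_closure hfc hgc Set.inter_subset_left
    ((dense_compl_singleton 0).open_subset_closure_inter isOpen_disc)

theorem HasWeight.hasWeight_dbar (hf : HasWeight m f) (hfd : DifferentiableOn ℝ f disc) :
    HasWeight (m + 1) (dbar f) := by
  intro a z hz
  have hdiff {w : ℂ} (hw : w ∈ disc) := hfd.differentiableAt (isOpen_disc.mem_nhds hw)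
  have hrotate := dbar_eq_of_hasFDerivAt
    (hasFDerivAt_comp_mul_left (a : ℂ) (hdiff ((circle_mul_mem_disc a).2 hz)))
  rw [dbar_eqOn isOpen_disc (hf a) hz, dbar_const_mul _ (hdiff hz)] at hrotate
  rw [zpow_add_one₀ (Circle.coe_ne_zero a)]
  linear_combination (-(dbar f (a * z))) * circle_mul_conj a - a * hrotate

theorem HasWeight.euler (hf : HasWeight m f) (hz : z ∈ disc) (hfd : DifferentiableAt ℝ f z) :
    z * dz f z - conj z * dbar f z = m * f z := by
  have hexp (n : ℤ) (c : ℂ) :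
      HasDerivAt (fun θ : ℝ => (Circle.exp θ : ℂ) ^ n * c) (n * Complex.I * c) 0 := by
    have hphase : HasDerivAt (fun θ : ℝ => n * (θ * Complex.I)) (n * (1 * Complex.I)) 0 :=
      (Complex.ofRealCLM.hasDerivAt.mul_const Complex.I).const_mul (n : ℂ)
    simpa [Circle.coe_exp, ← Complex.exp_int_mul] using hphase.cexp.mul_const c
  have hcurve : HasDerivAt (fun θ : ℝ => (Circle.exp θ : ℂ) * z) (Complex.I * z) 0 := by
    simpa using hexp 1 z
  have hchain := HasFDerivAt.comp_hasDerivAt (0 : ℝ) (f := fun θ : ℝ => (Circle.exp θ : ℂ) * z)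
    (by simpa using hasFDerivAt_wirtinger hfd) hcurve
  have hunique := hchain.unique ((hexp m (f z)).congr_of_eventuallyEq
    (Eventually.of_forall fun θ => hf (Circle.exp θ) z hz))
  simp only [wirtinger_apply, map_mul, Complex.conj_I] at hunique
  linear_combination -Complex.I * hunique -
    (m * f z - z * dz f z + conj z * dbar f z) * Complex.I_sq

theorem HasWeight.hasDerivAt_ofReal {x : ℝ} (hf : HasWeight m f) (hx : x ∈ Set.Ioo (0 : ℝ) 1)
    (hfd : DifferentiableOn ℝ f disc) :
    HasDerivAt (fun y : ℝ => f y) (m / x * f x + 2 * dbar f x) x := by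
  have hxD := ofReal_mem_disc hx
  have hdiff := hfd.differentiableAt (isOpen_disc.mem_nhds hxD)
  have hx0 : (x : ℂ) ≠ 0 := Complex.ofReal_ne_zero.2 hx.1.ne'
  have hderiv := HasFDerivAt.comp_hasDerivAt x (hasFDerivAt_wirtinger hdiff)
    (Complex.ofRealCLM.hasDerivAt (x := x))
  have heuler := hf.euler hxD hdiff
  refine hderiv.congr_deriv ?_
  simp only [Complex.conj_ofReal] at heuler
  simp only [wirtinger_apply, Complex.ofRealCLM_apply, Complex.ofReal_one, map_one, mul_one]
  field_simp
  linear_combination heuler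

end HasWeight

section RadialSystem

variable {s t r : ℂ} {m : ℤ} {u v : ℂ → ℂ} {x : ℝ}

theorem IsSolution.differentiableOn (hu : IsSolution s t r u) : DifferentiableOn ℝ u disc :=
  hu.1.differentiableOn two_ne_zero

theorem IsSolution.contDiffOn_dbar (hu : IsSolution s t r u) : ContDiffOn ℝ 1 (dbar u) disc :=
  GenHarm.contDiffOn_dbar (n := 1) isOpen_disc hu.1

theorem IsSolution.hasDerivAt_dbar_ofReal (hu : IsSolution s t r u) (hm : HasWeight m u)
    (hx : x ∈ Set.Ioo (0 : ℝ) 1) :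
    HasDerivAt (fun y : ℝ => dbar u y)
      (2 * (s * m + r) * u x + (-(m + 1) / x + 2 * (s + t) * x) * dbar u x) x := by
  have hxD := ofReal_mem_disc hx
  have hx0 : (x : ℂ) ≠ 0 := Complex.ofReal_ne_zero.2 hx.1.ne'
  have hdbar := hu.contDiffOn_dbar.differentiableOn one_ne_zero
  have hdiff := hu.differentiableOn.differentiableAt (isOpen_disc.mem_nhds hxD)
  have heuler := hm.euler hxD hdiff
  have heuler' := (hm.hasWeight_dbar hu.differentiableOn).euler hxD
    (hdbar.differentiableAt (isOpen_disc.mem_nhds hxD))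
  have hop := hu.2 x hxD
  refine ((hm.hasWeight_dbar hu.differentiableOn).hasDerivAt_ofReal hx hdbar).congr_deriv ?_
  simp only [opM, Complex.conj_ofReal] at heuler heuler' hop
  push_cast at heuler'
  push_cast
  field_simp
  linear_combination -2 * heuler' + 2 * x * hop + 2 * x * s * heuler

theorem abel (hu : IsSolution s t r u) (hum : HasWeight m u) (hv : IsSolution s t r v)
    (hvm : HasWeight m v) (hx : x ∈ Set.Ioo (0 : ℝ) 1) :
    HasDerivAt (fun y : ℝ => y * Complex.exp (-(s + t) * (y * y)) *
      (u y * dbar v y - v y * dbar u y)) 0 x := by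
  have hx0 : (x : ℂ) ≠ 0 := Complex.ofReal_ne_zero.2 hx.1.ne'
  have hid : HasDerivAt (fun y : ℝ => (y : ℂ)) 1 x := Complex.ofRealCLM.hasDerivAt
  have hexp := ((hid.mul hid).const_mul (-(s + t))).cexp
  have hwronskian :=
    ((hum.hasDerivAt_ofReal hx hu.differentiableOn).mul (hv.hasDerivAt_dbar_ofReal hvm hx)).sub
    ((hvm.hasDerivAt_ofReal hx hv.differentiableOn).mul (hu.hasDerivAt_dbar_ofReal hum hx))
  refine ((hid.mul hexp).mul hwronskian).congr_deriv ?_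
  simp only [Pi.mul_apply, Pi.sub_apply]
  field_simp
  ring

theorem wronskian_eq_zero (hu : IsSolution s t r u) (hum : HasWeight m u)
    (hv : IsSolution s t r v) (hvm : HasWeight m v) (hx : x ∈ Set.Ioo (0 : ℝ) 1) :
    u x * dbar v x = v x * dbar u x := by
  set W : ℝ → ℂ := fun y => y * Complex.exp (-(s + t) * (y * y)) *
    (u y * dbar v y - v y * dbar u y) with hW
  have hcont : ContinuousOn W (Set.Ico 0 1) := by
    have hmaps : Set.MapsTo (fun y : ℝ => (y : ℂ)) (Set.Ico 0 1) disc := fun y hy => by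
      simpa [mem_disc, abs_of_nonneg hy.1] using hy.2
    have hrestrict {f : ℂ → ℂ} (hf : ContinuousOn f disc) :
        ContinuousOn (fun y : ℝ => f y) (Set.Ico 0 1) :=
      hf.comp Complex.continuous_ofReal.continuousOn hmaps
    have hu0 := hrestrict hu.1.continuousOn
    have hv0 := hrestrict hv.1.continuousOn
    have hu1 := hrestrict hu.contDiffOn_dbar.continuousOn
    have hv1 := hrestrict hv.contDiffOn_dbar.continuousOn
    have hid := hrestrict continuousOn_id
    exact (hid.mul (continuousOn_const.mul (hid.mul hid)).cexp).mul
      ((hu0.mul hv1).sub (hv0.mul hu1))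
  have hconst : W x = W 0 := by
    have hint := intervalIntegral.integral_eq_sub_of_hasDerivAt_of_le hx.1.le
      (hcont.mono (Set.Icc_subset_Ico_right hx.2))
      (fun y hy => abel hu hum hv hvm ⟨hy.1, hy.2.trans hx.2⟩) intervalIntegrable_const
    rw [intervalIntegral.integral_zero] at hint
    exact sub_eq_zero.1 hint.symm
  have hfactor : (x * Complex.exp (-(s + t) * (x * x)) : ℂ) ≠ 0 :=
    mul_ne_zero (Complex.ofReal_ne_zero.2 hx.1.ne') (Complex.exp_ne_zero _)
  have hzero : W x = 0 := hconst.trans (by simp [hW])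
  exact sub_eq_zero.1 ((mul_eq_zero.1 hzero).resolve_left hfactor)

end RadialSystem

theorem eqOn_Ioo_of_hasDerivAt_linear {E : Type*} [NormedAddCommGroup E] [NormedSpace ℝ E]
    {A : ℝ → E →L[ℝ] E} {f g : ℝ → E} {a b x₀ : ℝ} (hA : ContinuousOn A (Set.Ioo a b))
    (hf : ∀ x ∈ Set.Ioo a b, HasDerivAt f (A x (f x)) x)
    (hg : ∀ x ∈ Set.Ioo a b, HasDerivAt g (A x (g x)) x) (hx₀ : x₀ ∈ Set.Ioo a b)
    (h : f x₀ = g x₀) : Set.EqOn f g (Set.Ioo a b) := by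
  intro x hx
  obtain ⟨c, hac, hc⟩ := exists_between (lt_min hx.1 hx₀.1)
  obtain ⟨d, hd, hdb⟩ := exists_between (max_lt hx.2 hx₀.2)
  obtain ⟨hcx, hcx₀⟩ := lt_min_iff.1 hc
  obtain ⟨hxd, hx₀d⟩ := max_lt_iff.1 hd
  obtain ⟨C, hC⟩ := isCompact_Icc.exists_bound_of_continuousOn
    (hA.mono (Set.Icc_subset_Ioo hac hdb))
  have hsub : Set.Ioo c d ⊆ Set.Ioo a b := Set.Ioo_subset_Ioo hac.le hdb.le
  refine ODE_solution_unique_of_mem_Ioo (v := fun x => A x) (s := fun _ => Set.univ)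
    (K := C.toNNReal) (fun y hy => ?_) ⟨hcx₀, hx₀d⟩ (fun y hy => ⟨hf y (hsub hy), trivial⟩)
    (fun y hy => ⟨hg y (hsub hy), trivial⟩) h ⟨hcx, hxd⟩
  exact ((A y).lipschitz.weaken
    (NNReal.le_toNNReal_of_coe_le (hC y (Set.Ioo_subset_Icc_self hy)))).lipschitzOnWith

section OneDimensional

variable {s t r : ℂ} {m : ℤ} {u v : ℂ → ℂ}

/-- The matrix of the linear system satisfied by `(u, ∂̄u)` on the radius `(0, 1)`, for a solution
`u` of weight `m`. -/
def radialMatrix (s t r : ℂ) (m : ℤ) (x : ℝ) : ℂ × ℂ →L[ℝ] ℂ × ℂ :=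
  let fst := ContinuousLinearMap.fst ℝ ℂ ℂ
  let snd := ContinuousLinearMap.snd ℝ ℂ ℂ
  (m / x : ℂ) • (ContinuousLinearMap.inl ℝ ℂ ℂ).comp fst +
    (2 : ℂ) • (ContinuousLinearMap.inl ℝ ℂ ℂ).comp snd +
    (2 * (s * m + r)) • (ContinuousLinearMap.inr ℝ ℂ ℂ).comp fst +
    (-(m + 1) / x + 2 * (s + t) * x) • (ContinuousLinearMap.inr ℝ ℂ ℂ).comp snd

theorem radialMatrix_apply (x : ℝ) (p q : ℂ) :
    radialMatrix s t r m x (p, q) =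
      (m / x * p + 2 * q, 2 * (s * m + r) * p + (-(m + 1) / x + 2 * (s + t) * x) * q) := by
  simp [radialMatrix]

theorem continuousOn_radialMatrix : ContinuousOn (radialMatrix s t r m) (Set.Ioo 0 1) := by
  have hinv : ContinuousOn (fun x : ℝ => (x : ℂ)⁻¹) (Set.Ioo 0 1) :=
    Complex.continuous_ofReal.continuousOn.inv₀ fun x hx => Complex.ofReal_ne_zero.2 hx.1.ne'
  unfold radialMatrix
  simp only [div_eq_mul_inv]
  have hid : ContinuousOn (fun x : ℝ => (x : ℂ)) (Set.Ioo 0 1) :=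
    Complex.continuous_ofReal.continuousOn
  fun_prop

theorem IsSolution.hasDerivAt_radial (hu : IsSolution s t r u) (hum : HasWeight m u) {x : ℝ}
    (hx : x ∈ Set.Ioo (0 : ℝ) 1) :
    HasDerivAt (fun y : ℝ => (u y, dbar u y)) (radialMatrix s t r m x (u x, dbar u x)) x := by
  rw [radialMatrix_apply]
  exact (hum.hasDerivAt_ofReal hx hu.differentiableOn).prodMk (hu.hasDerivAt_dbar_ofReal hum hx)

theorem exists_eqOn_const_mul (hu : IsSolution s t r u) (hum : HasWeight m u)
    (hv : IsSolution s t r v) (hvm : HasWeight m v) {x₀ : ℝ} (hx₀ : x₀ ∈ Set.Ioo (0 : ℝ) 1)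
    (hvx₀ : v x₀ ≠ 0) : ∃ k, Set.EqOn u (fun z => k * v z) disc := by
  refine ⟨u x₀ / v x₀, hum.eqOn (hvm.const_mul _) hu.1.continuousOn
    (continuousOn_const.mul hv.1.continuousOn) fun x hx => ?_⟩
  set k := u x₀ / v x₀ with hk
  have hradial : Set.EqOn (fun y : ℝ => (u y, dbar u y)) (fun y : ℝ => k • (v y, dbar v y))
      (Set.Ioo 0 1) := by
    refine eqOn_Ioo_of_hasDerivAt_linear continuousOn_radialMatrix
      (fun y hy => hu.hasDerivAt_radial hum hy) (fun y hy => ?_) hx₀ ?_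
    · refine ((hv.hasDerivAt_radial hvm hy).const_smul k).congr_deriv ?_
      simp only [radialMatrix_apply, Prod.smul_mk, smul_eq_mul, Prod.mk.injEq]
      constructor <;> ring
    · have hwronskian := wronskian_eq_zero hu hum hv hvm hx₀
      simp only [hk, Prod.smul_mk, smul_eq_mul, Prod.mk.injEq]
      constructor
      · field_simp
      · field_simp
        linear_combination -hwronskian
  exact (Prod.ext_iff.1 (hradial hx)).1

end OneDimensional

/-! ### The expansion -/

theorem hasSum_int_iff {M : Type*} [AddCommGroup M] [UniformSpace M] [IsUniformAddGroup M]
    [CompleteSpace M] [T2Space M] {f : ℤ → M} {c : M} :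
    HasSum f c ↔ ∃ a b, HasSum (fun m : ℕ => f m) a ∧
      HasSum (fun m : {m : ℕ // 1 ≤ m} => f (-(m : ℕ))) b ∧ c = a + b := by
  have hadd {a b : M} (ha : HasSum (fun m : ℕ => f m) a)
      (hb : HasSum (fun m : {m : ℕ // 1 ≤ m} => f (-(m : ℕ))) b) : HasSum f (a + b) := by
    exact ha.of_nat_of_neg_add_one (Equiv.pnatEquivNat.symm.hasSum_iff.2 hb)
  constructor
  · intro h
    have ha := (h.summable.comp_injective Nat.cast_injective).hasSum
    have hb := (h.summable.comp_injective
      (neg_injective.comp (Nat.cast_injective.comp (Subtype.val_injective (p := (1 ≤ ·)))))).hasSum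
    exact ⟨_, _, ha, hb, h.unique (hadd ha hb)⟩
  · rintro ⟨a, b, ha, hb, rfl⟩
    exact hadd ha hb

section Terms

variable (s t r : ℂ) (m : ℤ)

theorem term_natCast (k : ℤ → ℂ) (m : ℕ) (z : ℂ) :
    term s t r k m z =
      k m * calP (r + s * m) (s + t) (m + 1) ((‖z‖ : ℂ) ^ 2) * z ^ m := by
  simp [term]

theorem term_neg_natCast (k : ℤ → ℂ) {m : ℕ} (hm : 1 ≤ m) (z : ℂ) :
    term s t r k (-m) z =
      k (-m) * calP (r + t * m) (t + s) (m + 1) ((‖z‖ : ℂ) ^ 2) * conj z ^ m := by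
  rw [term, if_neg (by omega), Int.natAbs_neg, Int.natAbs_natCast]

theorem term_eq_mul (k : ℤ → ℂ) (z : ℂ) : term s t r k m z = k m * term s t r 1 m z := by
  simp only [term_eq, Pi.one_apply, one_mul, mul_assoc]

theorem hasWeight_term (k : ℤ → ℂ) : HasWeight m (term s t r k m) := by
  intro a z _
  have hmodulus : a * z * conj (a * z : ℂ) = z * conj z := by
    rw [map_mul]
    linear_combination z * conj z * circle_mul_conj a
  have hpow : (a : ℂ) ^ m.toNat * conj (a : ℂ) ^ (-m).toNat = (a : ℂ) ^ m := by
    rw [← Circle.coe_inv_eq_conj, Circle.coe_inv, inv_pow, ← zpow_natCast, ← zpow_natCast,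
      ← zpow_neg, ← zpow_add₀ a.coe_ne_zero, show (m.toNat : ℤ) + -(-m).toNat = m by omega]
  rw [term_eq, term_eq, hmodulus, map_mul, ← hpow]
  ring

theorem isSolution_term : IsSolution s t r (term s t r 1 m) := by
  have hsum := (rootCondition_one.discSummable_expCoeff s t r).indicator (weight ⁻¹' {m})
  rw [term_eq_doubleSeries]
  refine ⟨hsum.contDiffOn_nat 2, hsum.opM_doubleSeries ?_⟩
  intro p q
  classical
  simp only [Set.indicator_apply, Set.mem_preimage, weight_succ_succ]
  split_ifs
  · exact expCoeff_succ s t r 1 p q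
  · simp

theorem exists_term_ne_zero : ∃ x ∈ Set.Ioo (0 : ℝ) 1, term s t r 1 m x ≠ 0 := by
  have hsq : Tendsto (fun x : ℝ => (x : ℂ) * conj (x : ℂ)) (𝓝[>] 0) (𝓝 0) := by
    have hcont : Continuous fun x : ℝ => (x : ℂ) * conj (x : ℂ) := by fun_prop
    simpa using (hcont.tendsto 0).mono_left nhdsWithin_le_nhds
  have hcalP := (tendsto_calP_nhds_zero (by positivity) (norm_parameter_le s t r m)).comp hsq
  obtain ⟨x, hx, hx01⟩ :=
    ((hcalP.eventually_ne one_ne_zero).and (Ioo_mem_nhdsGT one_pos)).exists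
  have hx0 : (x : ℂ) ≠ 0 := Complex.ofReal_ne_zero.2 hx01.1.ne'
  refine ⟨x, hx01, ?_⟩
  rw [term_eq]
  simpa [hx0] using hx

theorem tendsto_calP_parameter_atTop (x : ℂ) :
    Tendsto (fun m : ℤ => calP (r + s * m.toNat + t * (-m).toNat) (s + t) (m.natAbs + 1) x) atTop
      (𝓝 (Complex.exp (s * x))) := by
  rw [← Nat.map_cast_int_atTop, tendsto_map'_iff]
  simpa [Function.comp_def] using tendsto_calP_atTop r s (s + t) x

theorem tendsto_calP_parameter_atBot (x : ℂ) :
    Tendsto (fun m : ℤ => calP (r + s * m.toNat + t * (-m).toNat) (s + t) (m.natAbs + 1) x) atBot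
      (𝓝 (Complex.exp (t * x))) := by
  refine ((tendsto_calP_parameter_atTop t s r x).comp tendsto_neg_atBot_atTop).congr fun m => ?_
  rw [Function.comp_apply, neg_neg, Int.natAbs_neg, add_right_comm, add_comm t s]

theorem norm_term_one {x : ℝ} (hx : 0 ≤ x) :
    ‖term s t r 1 m x‖ =
      ‖calP (r + s * m.toNat + t * (-m).toNat) (s + t) (m.natAbs + 1) (x * x)‖ *
        x ^ m.natAbs := by
  rw [term_eq, Complex.conj_ofReal, ← pow_add, show m.toNat + (-m).toNat = m.natAbs by omega,
    norm_mul, norm_mul, norm_pow, Complex.norm_of_nonneg hx]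
  simp

theorem exists_eventually_mul_pow_le_norm_term {R : ℝ} (hR : 0 ≤ R) :
    ∃ δ > 0, ∀ᶠ m in cofinite, δ * R ^ m.natAbs ≤ ‖term s t r 1 m R‖ := by
  obtain ⟨δ, hδ, hδexp⟩ := exists_between
    (lt_min (norm_pos_iff.2 (Complex.exp_ne_zero (s * (R * R))))
      (norm_pos_iff.2 (Complex.exp_ne_zero (t * (R * R)))))
  obtain ⟨hδs, hδt⟩ := lt_min_iff.1 hδexp
  refine ⟨δ, hδ, ?_⟩
  rw [Int.cofinite_eq, eventually_sup]
  constructor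
  · filter_upwards [(tendsto_calP_parameter_atBot s t r _).norm.eventually_const_lt hδt] with m hm
    rw [norm_term_one s t r m hR]
    gcongr
  · filter_upwards [(tendsto_calP_parameter_atTop s t r _).norm.eventually_const_lt hδs] with m hm
    rw [norm_term_one s t r m hR]
    gcongr

end Terms

section Expansion

variable {s t r : ℂ} {u : ℂ → ℂ}

theorem IsSolution.exists_eqOn_weightPart (hu : IsSolution s t r u) :
    ∃ k : ℤ → ℂ, ∀ m, Set.EqOn (weightPart m u) (term s t r k m) disc := by
  have hmultiple (m : ℤ) :
      ∃ k, Set.EqOn (weightPart m u) (fun z => k * term s t r 1 m z) disc := by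
    obtain ⟨x, hx, hne⟩ := exists_term_ne_zero s t r m
    exact exists_eqOn_const_mul (hu.weightPart m) (hasWeight_weightPart m u)
      (isSolution_term s t r m) (hasWeight_term s t r m 1) hx hne
  choose k hk using hmultiple
  exact ⟨k, fun m z hz => (hk m hz).trans (term_eq_mul s t r m k z).symm⟩

theorem rootCondition_of_eqOn_weightPart {k : ℤ → ℂ} (hu : ContinuousOn u disc)
    (hk : ∀ m, Set.EqOn (weightPart m u) (term s t r k m) disc) : RootCondition k := by
  refine rootCondition_of_eventually_le fun R hR => ?_
  obtain ⟨C, hC⟩ := exists_norm_le_of_continuousOn hu hR.2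
  obtain ⟨δ, hδ, hlower⟩ := exists_eventually_mul_pow_le_norm_term s t r hR.1.le
  refine ⟨C / δ, hlower.mono fun m hm => ?_⟩
  have hupper : ‖weightPart m u R‖ ≤ C := norm_weightPart_le m fun w hw => hC w (by
    rw [hw, Complex.norm_of_nonneg hR.1.le])
  rw [le_div_iff₀ hδ]
  calc ‖k m‖ * R ^ m.natAbs * δ = ‖k m‖ * (δ * R ^ m.natAbs) := by ring
    _ ≤ ‖k m‖ * ‖term s t r 1 m R‖ := by gcongr
    _ = ‖weightPart m u R‖ := by
        rw [hk m (ofReal_mem_disc hR), term_eq_mul s t r m k, norm_mul]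
    _ ≤ C := hupper

theorem isSolution_iff_exists_hasSum_term :
    IsSolution s t r u ↔
      ∃ k, RootCondition k ∧ ∀ z ∈ disc, HasSum (fun m => term s t r k m z) (u z) := by
  constructor
  · intro hu
    obtain ⟨k, hk⟩ := hu.exists_eqOn_weightPart
    have hroot := rootCondition_of_eqOn_weightPart hu.1.continuousOn hk
    refine ⟨k, hroot, fun z hz => ?_⟩
    simp only [← hk _ hz]
    refine hasSum_weightPart hu.1.continuousOn hz ?_
    simpa only [hk _ hz] using (hroot.hasSum_term s t r hz).summable
  · rintro ⟨k, hk, hsum⟩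
    exact (hk.isSolution_doubleSeries s t r).congr fun z hz =>
      (hsum z hz).unique (hk.hasSum_term s t r hz)

end Expansion

theorem RootCondition.absConvergent_term (s t r : ℂ) {k : ℤ → ℂ} (hk : RootCondition k) :
    AbsConvergent (term s t r k) := by
  simpa only [← term_eq_doubleSeries] using (hk.discSummable_expCoeff s t r).absConvergent weight

theorem RootCondition.hasSmoothSum_term (s t r : ℂ) {k : ℤ → ℂ} (hk : RootCondition k) :
    HasSmoothSum (term s t r k) fun z => ∑' m, term s t r k m z := by
  simpa only [← term_eq_doubleSeries] using
    (hk.discSummable_expCoeff s t r).hasSmoothSum weight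
      fun z hz => (hk.hasSum_term s t r hz).tsum_eq

end GenHarm

end

theorem mainTheorem1 (s t r : ℂ) :
    (∀ u : ℂ → ℂ, GenHarm.IsSolution s t r u ↔
      ∃ k : ℤ → ℂ, GenHarm.RootCondition k ∧
        ∀ z ∈ GenHarm.disc, ∃ a b : ℂ,
          HasSum (fun m : ℕ =>
            k m * GenHarm.calP (r + s * m) (s + t) (m + 1) ((‖z‖ : ℂ) ^ 2) * z ^ m) a ∧
          HasSum (fun m : {m : ℕ // 1 ≤ m} =>
            k (-(m : ℤ)) * GenHarm.calP (r + t * (m : ℕ)) (t + s) ((m : ℕ) + 1)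
              ((‖z‖ : ℂ) ^ 2) * starRingEnd ℂ z ^ (m : ℕ)) b ∧
          u z = a + b) ∧
    (∀ k : ℤ → ℂ, GenHarm.RootCondition k →
      GenHarm.AbsConvergent (GenHarm.term s t r k) ∧
      GenHarm.HasSmoothSum (GenHarm.term s t r k)
        (fun z => ∑' m : ℤ, GenHarm.term s t r k m z)) := by
  refine ⟨fun u => ?_, fun k hk => ⟨hk.absConvergent_term s t r, hk.hasSmoothSum_term s t r⟩⟩
  have hsplit (k : ℤ → ℂ) (z c : ℂ) :=
    GenHarm.hasSum_int_iff (f := fun m => GenHarm.term s t r k m z) (c := c)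
  simp only [GenHarm.term_natCast, GenHarm.term_neg_natCast _ _ _ _ (Subtype.prop _)] at hsplit
  rw [GenHarm.isSolution_iff_exists_hasSum_term]
  simp only [hsplit]
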